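/- Let $\mathbb{A}$ be a commutative associative algebra with unit over $\mathbb{C}$ of finite dimension $n$, with its canonical (finite-dimensional) topology. Let $2\le k\le 2n$, let $e_1=1,e_2,\ldots,e_k\in\mathbb{A}$ be linearly independent over $\mathbb{R}$, and let $E_k=\{\sum_{j=1}^k x_je_j : x_j\in\mathbb{R}\}$ be their real linear span. Let $\Omega\subset E_k$ be a domain (nonempty, open and connected in $E_k$), and let $\Phi:\Omega\to\mathbb{A}$ be monogenic in $\Omega$, that is, $\Phi$ is continuous and for every $\zeta\in\Omega$ there is an element $\Phi'(\zeta)\in\mathbb{A}$ such that $$\lim_{\varepsilon\to 0+}\frac{\Phi(\zeta+\varepsilon h)-\Phi(\zeta)}{\varepsilon}=h\,\Phi'(\zeta)\qquad\text{for all } h\in E_k .$$ Let $\Sigma\subset\Omega$ be a compact oriented piecewise-smooth two-dimensional surface whose edge $\gamma$ is a closed rectifiable Jordan curve. Here $\Sigma$ is given by a finite oriented triangulated surface $K$ with boundary $\partial K$ and a continuous, locally injective map $f:|K|\to\Omega$ with $f(|K|)=\Sigma$ that is continuously differentiable with derivative of rank two in the interior of every triangle, and $\gamma$ being the edge of $\Sigma$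 means that $f$ maps $|\partial K|$ injectively onto $\gamma$. Then, in either direction of $\gamma$, $$\int_\gamma\Phi(\zeta)\,d\zeta=0,$$ where, with $d\zeta=e_1dx_1+\ldots+e_kdx_k$, the integral is $\sum_{j=1}^k e_j\int_\gamma\Phi\,dx_j$, understood as a limit of Riemann–Stieltjes sums over partitions of $\gamma$; in particular this limit exists. -/

import Mathlib

open Set Filter Topology

/-! ### The real span and monogenic functions -/

section Monogenic

variable {A : Type*} [NormedCommRing A] [NormedAlgebra ℂ A] {k : ℕ}

/-- The real linear span `E_k = {∑ x_j e_j : x_j ∈ ℝ}` of the vectors `e_1, …, e_k`. -/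
noncomputable abbrev realSpan (e : Fin k → A) : Submodule ℝ A := Submodule.span ℝ (Set.range e)

/-- `Φ` is monogenic in `Ω ⊆ E_k`: it is continuous there and at every `ζ ∈ Ω` it has a Gateaux
derivative, i.e. one element `d = Φ'(ζ)` of the algebra such that
`(Φ(ζ + ε h) - Φ(ζ)) ε⁻¹ → h d` as `ε → 0+`, for all `h ∈ E_k`.
Only the values of `Φ` on the open set `Ω` matter. -/
def IsMonogenicOn {e : Fin k → A} (Φ : realSpan e → A) (Ω : Set (realSpan e)) : Prop :=
  ContinuousOn Φ Ω ∧
    ∀ ζ ∈ Ω, ∃ d : A, ∀ h : realSpan e,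
      Tendsto (fun ε : ℝ => ε⁻¹ • (Φ (ζ + ε • h) - Φ ζ)) (𝓝[>] 0) (𝓝 ((h : A) * d))

end Monogenic

/-! ### Rectifiable Jordan curves and the curvilinear integral -/

/-- `γ`, restricted to `[0, 1]`, is a parametrization of a (closed) rectifiable Jordan curve:
continuous, closed, without other double points, and of finite length. -/
structure IsRectifiableJordanCurve {E : Type*} [NormedAddCommGroup E] (γ : ℝ → E) : Prop where
  continuousOn : ContinuousOn γ (Icc 0 1)
  closed : γ 0 = γ 1
  injOn : InjOn γ (Ico 0 1)
  rectifiable : BoundedVariationOn γ (Icc 0 1)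

/-- `∫_γ Φ(ζ) dζ` exists and equals `I`. The integral is the Riemann–Stieltjes integral with
respect to `dζ = ∑ e_j dx_j`: the limit of the sums `∑ Φ(γ(τ_i)) (γ(t_{i+1}) - γ(t_i))` over
tagged partitions of `[0, 1]` as the mesh tends to zero. -/
def HasCurveIntegral {A : Type*} [NormedCommRing A] [NormedAlgebra ℂ A] {k : ℕ} {e : Fin k → A}
    (Φ : realSpan e → A) (γ : ℝ → realSpan e) (I : A) : Prop :=
  ∀ ε > (0 : ℝ), ∃ δ > (0 : ℝ), ∀ (p : ℕ) (t τ : ℕ → ℝ), t 0 = 0 → t p = 1 →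
    (∀ i < p, t i ≤ τ i ∧ τ i ≤ t (i + 1) ∧ t (i + 1) - t i < δ) →
    ‖∑ i ∈ Finset.range p, Φ (γ (τ i)) * ((γ (t (i + 1)) - γ (t i) : realSpan e) : A) - I‖ < ε

/-! ### Piecewise-smooth surfaces with edge -/

/-- `v` is a vertex of the triangle `s = (a, b, c)`. -/
def IsVertexOf {V : Type*} (v : V) (s : V × V × V) : Prop :=
  v = s.1 ∨ v = s.2.1 ∨ v = s.2.2

/-- `u → v` is one of the sides `a → b`, `b → c`, `c → a` of the oriented triangle
`s = (a, b, c)`. -/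
def IsSideOf {V : Type*} (u v : V) (s : V × V × V) : Prop :=
  (u = s.1 ∧ v = s.2.1) ∨ (u = s.2.1 ∧ v = s.2.2) ∨ (u = s.2.2 ∧ v = s.1)

/-- A finite triangulated oriented surface, possibly with boundary, with vertex set
`{0, …, N - 1}`. -/
structure TriangulatedSurface (N : ℕ) where
  /-- the triangles, each listed once, as a triple of vertices in positive cyclic order -/
  tri : Finset (Fin N × Fin N × Fin N)
  nondegenerate : ∀ s ∈ tri, s.1 ≠ s.2.1 ∧ s.2.1 ≠ s.2.2 ∧ s.1 ≠ s.2.2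
  /-- distinct triangles have distinct vertex sets -/
  simplicial : ∀ s ∈ tri, ∀ t ∈ tri, (∀ v, IsVertexOf v s ↔ IsVertexOf v t) → s = t
  /-- every directed edge is a side of at most one triangle: an edge lies in at most two
  triangles, and two triangles with a common edge induce opposite directions on it -/
  oriented : ∀ s ∈ tri, ∀ t ∈ tri, ∀ u v, IsSideOf u v s → IsSideOf u v t → s = t
  /-- the triangles around a vertex form one fan: any two of them are joined by a chain of
  triangles around that vertex in which neighbours have a common edge at the vertex -/
  fan : ∀ v, ∀ s ∈ tri, ∀ t ∈ tri, IsVertexOf v s → IsVertexOf v t →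
    Relation.ReflTransGen
      (fun p q => p ∈ tri ∧ q ∈ tri ∧ IsVertexOf v p ∧ IsVertexOf v q ∧
        ∃ w, w ≠ v ∧ IsVertexOf w p ∧ IsVertexOf w q) s t

namespace TriangulatedSurface

variable {N : ℕ} (K : TriangulatedSurface N)

/-- The `a`-th unit vector of `ℝ^N`, as the point that represents the vertex `a`. -/
noncomputable def vertex (a : Fin N) : Fin N → ℝ := Pi.single a 1

/-- The geometric realization `|K| ⊆ ℝ^N`: the union of the closed triangles. -/
def carrier : Set (Fin N → ℝ) :=
  ⋃ s ∈ K.tri, convexHull ℝ {vertex s.1, vertex s.2.1, vertex s.2.2}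

/-- `{u, v}` is a boundary edge: a side `u → v` of a triangle which is not the side `v → u` of
another one. -/
def IsBoundaryEdge (u v : Fin N) : Prop :=
  (∃ s ∈ K.tri, IsSideOf u v s) ∧ ∀ s ∈ K.tri, ¬ IsSideOf v u s

/-- The boundary `|∂K|`: the union of the closed boundary edges. -/
def boundary : Set (Fin N → ℝ) :=
  {x | ∃ u v, K.IsBoundaryEdge u v ∧ x ∈ segment ℝ (vertex u) (vertex v)}

end TriangulatedSurface

/-- The point of the triangle `s` with barycentric coordinates `1 - p.1 - p.2, p.1, p.2`. -/
noncomputable def trianglePoint {N : ℕ} (s : Fin N × Fin N × Fin N) (p : ℝ × ℝ) : Fin N → ℝ :=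
  (1 - p.1 - p.2) • TriangulatedSurface.vertex s.1 + p.1 • TriangulatedSurface.vertex s.2.1 +
    p.2 • TriangulatedSurface.vertex s.2.2

/-- The open triangle in the parameter plane. -/
def openTriangle : Set (ℝ × ℝ) := {p | 0 < p.1 ∧ 0 < p.2 ∧ p.1 + p.2 < 1}

/-- `f : |K| → E` is a parametrization of a piecewise-smooth surface: continuous and locally
injective on `|K|`, and continuously differentiable with derivative of rank two inside each
triangle. Smoothness is not required up to the sides of the triangles, so that the edge of the
surface may be any rectifiable curve; self-intersections of the surface are not excluded. -/
structure IsPiecewiseSmoothSurface {E : Type*} [NormedAddCommGroup E] [NormedSpace ℝ E] {N : ℕ}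
    (K : TriangulatedSurface N) (f : (Fin N → ℝ) → E) : Prop where
  continuousOn : ContinuousOn f K.carrier
  locallyInjective : ∀ x ∈ K.carrier, ∃ U ∈ 𝓝 x, InjOn f (U ∩ K.carrier)
  smooth : ∀ s ∈ K.tri, ContDiffOn ℝ 1 (fun p => f (trianglePoint s p)) openTriangle
  regular : ∀ s ∈ K.tri, ∀ p ∈ openTriangle,
    Function.Injective (fderiv ℝ (fun q => f (trianglePoint s q)) p)

/-- The curve `γ` is the edge of the surface parametrized by `f : |K| → E`: `f` maps the boundary
`|∂K|` injectively onto the trace of `γ`. (Either direction of `γ` is allowed.) -/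
def IsEdgeOf {E : Type*} {N : ℕ} (γ : ℝ → E) (K : TriangulatedSurface N)
    (f : (Fin N → ℝ) → E) : Prop :=
  InjOn f K.boundary ∧ f '' K.boundary = γ '' Icc 0 1

/-! The function is only continuous with directional derivatives, and `Φ'` need not be continuous,
so Stokes' theorem is not available and the local statement is of Looman–Menchoff type. On the plane
of a triangle with corners `x`, `y`, `z` put `F (s, t) = Φ (x + s (y - x) + t (z - x))`, and let
`L₁`, `L₂` be multiplication by `y - x` and `z - x`. The partial derivatives of `F` are `L₁ Φ'` and
`L₂ Φ'`, so commutativity of the algebra gives `∂ₛ (L₂ F) = ∂ₜ (L₁ F)`, and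
`rectIntegral_eq_zero_of_partialDeriv` shows that `L₁ F ds + L₂ F dt` has integral zero around
rectangles, hence around the triangle. In that theorem Baire's category theorem finds a portion of
the exceptional set on which `F` is Lipschitz; there `F` is compared with a Lipschitz function on
the whole plane, and the error is bounded by the area off the exceptional set.

Consequently the integrals of `Φ dζ` along segments form a local cocycle near the compact surface
(`exists_segmentIntegral_add`). The global part is combinatorial: the cocycle is pulled back by `f`
to `|K|`, where it has a primitive on every triangle. Summing over the sides of all triangles, the
inner sides cancel, so the boundary edges contribute zero in total.
`TriangulatedSurface.increment_boundary_loop_eq_zero` identifies this total, up to sign, with the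
period of a primitive along the lifted boundary curve.

Finally, since `γ` has finite length, its Riemann–Stieltjes sums are close to sums of segment
integrals over the same partition (`exists_norm_sum_sub_segmentIntegral_lt`), and the latter
telescope to the period, which is zero. -/

/-! ### Integrals around rectangles and subdivision. -/

section RectIntegral

open MeasureTheory intervalIntegral

variable {V : Type*} [NormedAddCommGroup V] [NormedSpace ℝ V]

/-- The integral of the form `P dx + Q dy` along the boundary of the rectangle
`[a, b] × [c, d]`. -/
noncomputable def rectIntegral (P Q : ℝ × ℝ → V) (a b c d : ℝ) : V :=
  (∫ x in a..b, (P (x, c) - P (x, d))) + ∫ y in c..d, (Q (b, y) - Q (a, y))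

variable {P Q : ℝ × ℝ → V}

theorem rectIntegral_self_left (P Q : ℝ × ℝ → V) (a c d : ℝ) : rectIntegral P Q a a c d = 0 := by
  simp [rectIntegral]

theorem rectIntegral_self_right (P Q : ℝ × ℝ → V) (a b c : ℝ) : rectIntegral P Q a b c c = 0 := by
  simp [rectIntegral]

theorem rectIntegral_add_left (hP : Continuous P) (hQ : Continuous Q) (a m b c d : ℝ) :
    rectIntegral P Q a m c d + rectIntegral P Q m b c d = rectIntegral P Q a b c d := by
  unfold rectIntegral
  have h1 : ∀ a b, IntervalIntegrable (fun x => P (x, c) - P (x, d)) volume a b := fun a b =>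
    Continuous.intervalIntegrable (by fun_prop) _ _
  have h2 : ∀ a b, IntervalIntegrable (fun y => Q (b, y) - Q (a, y)) volume c d := fun a b =>
    Continuous.intervalIntegrable (by fun_prop) _ _
  rw [← integral_add_adjacent_intervals (h1 a m) (h1 m b)]
  have : (fun y => Q (b, y) - Q (a, y)) = fun y => (Q (m, y) - Q (a, y)) + (Q (b, y) - Q (m, y)) := by
    ext y; abel
  rw [this, integral_add (h2 a m) (h2 m b)]
  abel

theorem rectIntegral_add_right (hP : Continuous P) (hQ : Continuous Q) (a b c m d : ℝ) :
    rectIntegral P Q a b c m + rectIntegral P Q a b m d = rectIntegral P Q a b c d := by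
  unfold rectIntegral
  have h1 : ∀ c d, IntervalIntegrable (fun x => P (x, c) - P (x, d)) volume a b := fun c d =>
    Continuous.intervalIntegrable (by fun_prop) _ _
  have h2 : ∀ c d, IntervalIntegrable (fun y => Q (b, y) - Q (a, y)) volume c d := fun c d =>
    Continuous.intervalIntegrable (by fun_prop) _ _
  rw [← integral_add_adjacent_intervals (h2 c m) (h2 m d)]
  have : (fun x => P (x, c) - P (x, d)) = fun x => (P (x, c) - P (x, m)) + (P (x, m) - P (x, d)) := by
    ext y; abel
  rw [this, integral_add (h1 c m) (h1 m d)]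
  abel

theorem rectIntegral_quarters (hP : Continuous P) (hQ : Continuous Q) (a m b c n d : ℝ) :
    rectIntegral P Q a b c d = rectIntegral P Q a m c n + rectIntegral P Q m b c n
      + rectIntegral P Q a m n d + rectIntegral P Q m b n d := by
  rw [rectIntegral_add_left hP hQ, add_assoc, rectIntegral_add_left hP hQ,
    rectIntegral_add_right hP hQ]

theorem continuous_rectIntegral (hP : Continuous P) (hQ : Continuous Q) {a b c d : ℝ → ℝ}
    (ha : Continuous a) (hb : Continuous b) (hc : Continuous c) (hd : Continuous d) :
    Continuous fun t => rectIntegral P Q (a t) (b t) (c t) (d t) := by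
  unfold rectIntegral
  have key : ∀ {u v : ℝ → ℝ} {g : ℝ → ℝ → V}, Continuous u → Continuous v →
      Continuous (Function.uncurry g) → Continuous fun t => ∫ x in (u t)..(v t), g t x := by
    intro u v g hu hv hg
    have hi : ∀ t a b, IntervalIntegrable (g t) volume a b := fun t a b =>
      Continuous.intervalIntegrable (by fun_prop) _ _
    -- Basing both integrals at `0` leaves one moving endpoint in each, the form that continuity of
    -- parametric integrals needs.
    have : (fun t => ∫ x in (u t)..(v t), g t x) =
        fun t => (∫ x in (0 : ℝ)..(v t), g t x) - ∫ x in (0 : ℝ)..(u t), g t x := by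
      ext t
      rw [integral_interval_sub_left (hi _ _ _) (hi _ _ _)]
    rw [this]
    exact (continuous_parametric_intervalIntegral_of_continuous hg hv).sub
      (continuous_parametric_intervalIntegral_of_continuous hg hu)
  refine (key ha hb ?_).add (key hc hd ?_)
  · simp only [Function.uncurry_def]; fun_prop
  · simp only [Function.uncurry_def]; fun_prop

/-- A property of rectangles that passes from the four quarters to the whole holds for a
rectangle if it holds for all small subrectangles of the same shape. -/
theorem rect_induction {p : ℝ → ℝ → ℝ → ℝ → Prop}
    (quarter : ∀ a b c d, a ≤ b → c ≤ d → p a ((a + b) / 2) c ((c + d) / 2) →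
      p ((a + b) / 2) b c ((c + d) / 2) → p a ((a + b) / 2) ((c + d) / 2) d →
      p ((a + b) / 2) b ((c + d) / 2) d → p a b c d)
    (m : ℕ) : ∀ {a b c d : ℝ}, a ≤ b → c ≤ d →
      (∀ a' b' c' d', a ≤ a' → a' ≤ b' → b' ≤ b → c ≤ c' → c' ≤ d' → d' ≤ d →
        b' - a' = (b - a) / 2 ^ m → d' - c' = (d - c) / 2 ^ m → p a' b' c' d') → p a b c d := by
  induction m with
  | zero =>
    intro a b c d hab hcd h
    exact h a b c d le_rfl hab le_rfl le_rfl hcd le_rfl (by simp) (by simp)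
  | succ m ih =>
    intro a b c d hab hcd h
    refine quarter a b c d hab hcd ?_ ?_ ?_ ?_ <;>
    · refine ih (by linarith) (by linarith) fun a' b' c' d' h1 h2 h3 h4 h5 h6 h7 h8 => ?_
      refine h a' b' c' d' (by linarith) h2 (by linarith) (by linarith) h5 (by linarith) ?_ ?_
      · rw [h7, pow_succ]; field_simp; ring
      · rw [h8, pow_succ]; field_simp; ring

theorem exists_div_two_pow_lt (x : ℝ) {ε : ℝ} (hε : 0 < ε) : ∃ m : ℕ, ∀ n ≥ m, x / 2 ^ n < ε := by
  have : Tendsto (fun n : ℕ => x / 2 ^ n) atTop (𝓝 0) :=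
    tendsto_const_nhds.div_atTop (tendsto_pow_atTop_atTop_of_one_lt one_lt_two)
  exact eventually_atTop.1 (this.eventually (gt_mem_nhds hε))

/-- The integral over the boundary of a rectangle vanishes if it vanishes locally. -/
theorem rectIntegral_eq_zero_of_locally (hP : Continuous P) (hQ : Continuous Q) {O : Set (ℝ × ℝ)}
    (hO : ∀ q ∈ O, ∃ r > 0, ∀ a b c d, a ≤ b → c ≤ d → Icc a b ×ˢ Icc c d ⊆ Metric.ball q r →
      rectIntegral P Q a b c d = 0) {a b c d : ℝ} (hab : a ≤ b) (hcd : c ≤ d)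
    (hR : Icc a b ×ˢ Icc c d ⊆ O) : rectIntegral P Q a b c d = 0 := by
  choose! r hr0 hr using hO
  obtain ⟨δ, hδ, hleb⟩ := lebesgue_number_lemma_of_metric
    (c := fun q : (Icc a b ×ˢ Icc c d : Set (ℝ × ℝ)) => Metric.ball (q : ℝ × ℝ) (r q))
    (isCompact_Icc.prod isCompact_Icc) (fun _ => Metric.isOpen_ball)
    (fun q hq => mem_iUnion.2 ⟨⟨q, hq⟩, Metric.mem_ball_self (hr0 q (hR hq))⟩)
  obtain ⟨m1, hm1⟩ := exists_div_two_pow_lt (b - a) hδ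
  obtain ⟨m2, hm2⟩ := exists_div_two_pow_lt (d - c) hδ
  have e1 := hm1 (max m1 m2) (le_max_left _ _)
  have e2 := hm2 (max m1 m2) (le_max_right _ _)
  refine rect_induction (p := fun a b c d => rectIntegral P Q a b c d = 0) ?_ (max m1 m2) hab hcd ?_
  · intro a b c d _ _ h1 h2 h3 h4
    rw [rectIntegral_quarters hP hQ a ((a + b) / 2) b c ((c + d) / 2) d, h1, h2, h3, h4]
    simp
  · intro a' b' c' d' h1 h2 h3 h4 h5 h6 h7 h8
    obtain ⟨q, hq⟩ := hleb (a', c') ⟨⟨h1, h2.trans h3⟩, ⟨h4, h5.trans h6⟩⟩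
    refine hr q (hR q.2) _ _ _ _ h2 h5 (Subset.trans ?_ hq)
    rintro ⟨x, y⟩ ⟨hx, hy⟩
    rw [Metric.mem_ball, Prod.dist_eq, max_lt_iff, Real.dist_eq, Real.dist_eq, abs_lt, abs_lt]
    obtain ⟨hx1, hx2⟩ := hx
    obtain ⟨hy1, hy2⟩ := hy
    refine ⟨⟨?_, ?_⟩, ?_, ?_⟩ <;> simp only at * <;> linarith

end RectIntegral

/-! ### A weak Green formula by difference quotients. -/

section CrossQuotient

open MeasureTheory intervalIntegral

variable {V : Type*} [NormedAddCommGroup V] [NormedSpace ℝ V]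

/-- After a shift the inner integral is the mean of `q` over `[b, b + h]` minus its mean over `[a, a
+ h]`. Written over `θ ∈ [0, 1]`, these means are continuous in `h` even at `h = 0`, so no
differentiability of `q` enters. -/
theorem tendsto_integral_diffQuotient [CompleteSpace V] {q : ℝ × ℝ → V} (hq : Continuous q) (a b c d : ℝ) :
    Tendsto (fun h : ℝ => ∫ y in c..d, ∫ x in a..b, h⁻¹ • (q (x + h, y) - q (x, y))) (𝓝[≠] 0)
      (𝓝 (∫ y in c..d, (q (b, y) - q (a, y)))) := by
  have hcont : Continuous fun h : ℝ =>
      ∫ y in c..d, ∫ θ in (0 : ℝ)..1, (q (b + h * θ, y) - q (a + h * θ, y)) := by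
    refine continuous_parametric_intervalIntegral_of_continuous' ?_ _ _
    refine continuous_parametric_intervalIntegral_of_continuous' ?_ _ _
    simp only [Function.uncurry_def]
    fun_prop
  have h0 := hcont.tendsto 0
  simp only [zero_mul, add_zero, intervalIntegral.integral_const, sub_zero, one_smul] at h0
  refine (h0.mono_left nhdsWithin_le_nhds).congr' ?_
  filter_upwards [self_mem_nhdsWithin] with h hh
  refine integral_congr fun y _ => ?_
  have hi : ∀ u v, IntervalIntegrable (fun x => q (x, y)) volume u v := fun u v =>
    Continuous.intervalIntegrable (by fun_prop) _ _
  have hi' : ∀ u v s, IntervalIntegrable (fun x => q (s + h * x, y)) volume u v := fun u v s =>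
    Continuous.intervalIntegrable (by fun_prop) _ _
  have hi2 : ∀ u v, IntervalIntegrable (fun x => q (x + h, y)) volume u v := fun u v =>
    Continuous.intervalIntegrable (by fun_prop) _ _
  rw [integral_sub (hi' _ _ _) (hi' _ _ _), intervalIntegral.integral_smul,
    integral_sub (hi2 _ _) (hi _ _),
    integral_comp_add_mul (fun x => q (x, y)) hh, integral_comp_add_mul (fun x => q (x, y)) hh,
    integral_comp_add_right (fun x => q (x, y)), ← smul_sub]
  congr 1
  simp only [mul_zero, add_zero, mul_one]
  rw [integral_interval_sub_interval_comm (hi (a + h) _) (hi _ _) (hi _ _),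
    integral_symm a (a + h), integral_symm b (b + h)]
  abel

/-- The difference quotient of step `h` that approximates `∂ₓ (L₂ F) - ∂ᵧ (L₁ F)`. -/
noncomputable def crossQuotient (L₁ L₂ : V →L[ℝ] V) (F : ℝ × ℝ → V) (h : ℝ) (p : ℝ × ℝ) : V :=
  L₂ (h⁻¹ • (F (p + (h, 0)) - F p)) - L₁ (h⁻¹ • (F (p + (0, h)) - F p))

variable {L₁ L₂ : V →L[ℝ] V} {F v : ℝ × ℝ → V}

theorem continuous_crossQuotient (hF : Continuous F) (h : ℝ) :
    Continuous (crossQuotient L₁ L₂ F h) := by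
  unfold crossQuotient
  fun_prop

theorem norm_crossQuotient_le {M h : ℝ} (hh : h ≠ 0) {p : ℝ × ℝ}
    (h1 : ‖F (p + (h, 0)) - F p‖ ≤ M * |h|) (h2 : ‖F (p + (0, h)) - F p‖ ≤ M * |h|) :
    ‖crossQuotient L₁ L₂ F h p‖ ≤ (‖L₁‖ + ‖L₂‖) * M := by
  have key : ∀ (L : V →L[ℝ] V) (z : V), ‖z‖ ≤ M * |h| → ‖L (h⁻¹ • z)‖ ≤ ‖L‖ * M := by
    intro L z hz
    refine (L.le_opNorm _).trans (mul_le_mul_of_nonneg_left ?_ (norm_nonneg _))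
    rw [norm_smul, norm_inv, Real.norm_eq_abs, inv_mul_le_iff₀ (abs_pos.2 hh)]
    linarith
  refine (norm_sub_le _ _).trans ?_
  rw [add_mul, add_comm]
  exact add_le_add (key _ _ h2) (key _ _ h1)

/-- This replaces Green's formula for a function that is merely continuous: Fubini reduces each of
the two quotients to one-dimensional means, the second one after exchanging the coordinates. -/
theorem tendsto_setIntegral_crossQuotient [CompleteSpace V] (hF : Continuous F) {a b c d : ℝ} (hab : a ≤ b)
    (hcd : c ≤ d) :
    Tendsto (fun h => ∫ p in Ioc a b ×ˢ Ioc c d, crossQuotient L₁ L₂ F h p) (𝓝[≠] 0)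
      (𝓝 (rectIntegral (fun p => L₁ (F p)) (fun p => L₂ (F p)) a b c d)) := by
  have hQ := tendsto_integral_diffQuotient (q := fun p => L₂ (F p)) (by fun_prop) a b c d
  have hP := tendsto_integral_diffQuotient (q := fun p => L₁ (F p.swap)) (by fun_prop) c d a b
  have hint : ∀ g : ℝ × ℝ → V, Continuous g →
      IntegrableOn g (Ioc a b ×ˢ Ioc c d) (volume.prod volume) := fun g hg => by
    refine (hg.continuousOn.integrableOn_compact (isCompact_Icc.prod isCompact_Icc)).mono_set
      (Set.prod_mono (Ioc_subset_Icc_self (a := a) (b := b)) (Ioc_subset_Icc_self (a := c) (b := d)))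
  have hlim := hQ.sub hP
  have hG : rectIntegral (fun p => L₁ (F p)) (fun p => L₂ (F p)) a b c d =
      (∫ y in c..d, (L₂ (F (b, y)) - L₂ (F (a, y)))) -
        ∫ x in a..b, (L₁ (F (Prod.swap (d, x))) - L₁ (F (Prod.swap (c, x)))) := by
    rw [rectIntegral, sub_eq_add_neg, ← intervalIntegral.integral_neg, add_comm]
    simp
  rw [hG]
  refine hlim.congr fun h => ?_
  rw [Measure.volume_eq_prod]
  unfold crossQuotient
  rw [integral_sub (hint _ (by fun_prop)) (hint _ (by fun_prop))]
  congr 1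
  · rw [← setIntegral_prod_swap, setIntegral_prod]
    · simp [integral_of_le, hab, hcd]
    · refine IntegrableOn.mono_set ?_ (prod_mono (Ioc_subset_Icc_self (a := c) (b := d))
        (Ioc_subset_Icc_self (a := a) (b := b)))
      refine ContinuousOn.integrableOn_compact (isCompact_Icc.prod isCompact_Icc)
        (Continuous.continuousOn ?_)
      fun_prop
  · rw [setIntegral_prod _ (hint _ (by fun_prop))]
    simp [integral_of_le, hab, hcd]

/-- The closed thickenings of a compact set decrease to it. The thin shell around `S` later bounds
both the effect of translating `S` and the small rectangles that meet `S`. -/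
theorem tendsto_volume_cthickening_diff {S : Set (ℝ × ℝ)} (hS : IsCompact S) :
    Tendsto (fun r => volume (Metric.cthickening r S \ S)) (𝓝 0) (𝓝 0) := by
  have h := tendsto_measure_cthickening_of_isCompact (μ := (volume : Measure (ℝ × ℝ))) hS
  have h2 : Tendsto (fun r => volume (Metric.cthickening r S) - volume S) (𝓝 0)
      (𝓝 (volume S - volume S)) :=
    ENNReal.Tendsto.sub h tendsto_const_nhds (Or.inl hS.measure_lt_top.ne)
  rw [tsub_self] at h2
  refine h2.congr fun r => ?_
  rw [measure_sdiff (Metric.self_subset_cthickening S) hS.measurableSet.nullMeasurableSet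
    hS.measure_lt_top.ne]

theorem volume_translate_notMem_le (S : Set (ℝ × ℝ)) (z : ℝ × ℝ) :
    volume {p | p ∈ S ∧ p + z ∉ S} ≤ volume (Metric.cthickening ‖z‖ S \ S) := by
  rw [← measure_preimage_add_right volume z (Metric.cthickening ‖z‖ S \ S)]
  refine measure_mono fun p hp => ⟨?_, hp.2⟩
  exact Metric.mem_cthickening_of_dist_le _ p _ _ hp.1 (by simp)

/-- The boundary integral is the limit of the area integrals of the cross quotient of `v`. Off `S`
the Lipschitz bound gives the right-hand side. On `S` the quotient of `v` may be replaced by that of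
`F`, except at points that the translation by `h` moves out of `S`; these have vanishing measure,
and the quotient of `F` tends to zero boundedly. -/
theorem norm_rectIntegral_le_of_lipschitz [CompleteSpace V] (hF : Continuous F) {M : NNReal} (hv : LipschitzWith M v)
    {S : Set (ℝ × ℝ)} (hS : IsCompact S) (hvF : EqOn v F S) {κ : ℝ} (hκ : 0 < κ)
    (hx : ∀ p ∈ S, ∀ t : ℝ, |t| ≤ κ → ‖F (p + (t, 0)) - F p‖ ≤ M * |t|)
    (hy : ∀ p ∈ S, ∀ t : ℝ, |t| ≤ κ → ‖F (p + (0, t)) - F p‖ ≤ M * |t|)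
    (hder : ∀ p ∈ S, Tendsto (fun h => crossQuotient L₁ L₂ F h p) (𝓝[≠] 0) (𝓝 0))
    {a b c d : ℝ} (hab : a ≤ b) (hcd : c ≤ d) :
    ‖rectIntegral (fun p => L₁ (v p)) (fun p => L₂ (v p)) a b c d‖ ≤
      (‖L₁‖ + ‖L₂‖) * M * (volume ((Ioc a b ×ˢ Ioc c d) \ S)).toReal := by
  set R : Set (ℝ × ℝ) := Ioc a b ×ˢ Ioc c d with hRdef
  set C : ℝ := (‖L₁‖ + ‖L₂‖) * M with hC
  have hC0 : 0 ≤ C := by positivity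
  have hRm : MeasurableSet R := measurableSet_Ioc.prod measurableSet_Ioc
  have hRfin : volume R < ⊤ :=
    (measure_mono (Set.prod_mono Ioc_subset_Icc_self Ioc_subset_Icc_self)).trans_lt
      ((isCompact_Icc.prod isCompact_Icc : IsCompact (Icc a b ×ˢ Icc c d)).measure_lt_top)
  have hint : ∀ g : ℝ × ℝ → V, Continuous g → IntegrableOn g R := fun g hg =>
    (hg.continuousOn.integrableOn_compact (isCompact_Icc.prod isCompact_Icc)).mono_set
      (Set.prod_mono (Ioc_subset_Icc_self (a := a) (b := b)) (Ioc_subset_Icc_self (a := c) (b := d)))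
  have hRS : volume (R ∩ S) < ⊤ := (measure_mono inter_subset_left).trans_lt hRfin
  have hvb : ∀ h ≠ 0, ∀ p, ‖crossQuotient L₁ L₂ v h p‖ ≤ C := fun h hh p =>
    norm_crossQuotient_le hh
      ((hv.norm_sub_le _ _).trans_eq (by simp)) ((hv.norm_sub_le _ _).trans_eq (by simp))
  have hFb : ∀ h ≠ 0, |h| ≤ κ → ∀ p ∈ S, ‖crossQuotient L₁ L₂ F h p‖ ≤ C := fun h hh hhκ p hp =>
    norm_crossQuotient_le hh (hx p hp h hhκ) (hy p hp h hhκ)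
  have hsmall : ∀ᶠ h in 𝓝[≠] (0 : ℝ), h ≠ 0 ∧ |h| ≤ κ := by
    refine (eventually_mem_nhdsWithin (a := (0 : ℝ)) (s := {0}ᶜ)).and
      (Eventually.filter_mono nhdsWithin_le_nhds ?_)
    filter_upwards [Metric.ball_mem_nhds (0 : ℝ) hκ] with h hh
    simpa using (mem_ball_zero_iff.1 hh).le
  have hlimF : Tendsto (fun h => ∫ p in R ∩ S, crossQuotient L₁ L₂ F h p) (𝓝[≠] 0) (𝓝 0) := by
    have := tendsto_integral_filter_of_dominated_convergence (μ := volume.restrict (R ∩ S))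
      (l := 𝓝[≠] (0 : ℝ)) (F := fun h p => crossQuotient L₁ L₂ F h p) (f := fun _ => (0 : V))
      (fun _ => C) (Eventually.of_forall fun h =>
        ((hint _ (continuous_crossQuotient hF h)).mono_set inter_subset_left).aestronglyMeasurable)
      (hsmall.mono fun h hh => (ae_restrict_iff' (hRm.inter hS.measurableSet)).2
        (Eventually.of_forall fun p hp => hFb h hh.1 hh.2 p hp.2))
      (integrableOn_const hRS.ne)
      ((ae_restrict_iff' (hRm.inter hS.measurableSet)).2
        (Eventually.of_forall fun p hp => hder p hp.2))
    simpa using this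
  have hlimN : Tendsto (fun h : ℝ => 2 * C * (2 * volume (Metric.cthickening |h| S \ S)).toReal)
      (𝓝[≠] 0) (𝓝 0) := by
    have h1 : Tendsto (fun h : ℝ => |h|) (𝓝[≠] 0) (𝓝 0) := by
      simpa using (continuous_abs.tendsto (0 : ℝ)).mono_left nhdsWithin_le_nhds
    have h2 := ENNReal.Tendsto.const_mul ((tendsto_volume_cthickening_diff hS).comp h1)
      (Or.inr (ENNReal.ofNat_ne_top (n := 2)))
    rw [mul_zero] at h2
    simpa using ((ENNReal.tendsto_toReal ENNReal.zero_ne_top).comp h2).const_mul (2 * C)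
  have hbound : ∀ᶠ h in 𝓝[≠] (0 : ℝ), ‖∫ p in R, crossQuotient L₁ L₂ v h p‖ ≤
      ‖∫ p in R ∩ S, crossQuotient L₁ L₂ F h p‖ +
        2 * C * (2 * volume (Metric.cthickening |h| S \ S)).toReal +
        C * (volume (R \ S)).toReal := by
    filter_upwards [hsmall] with h ⟨hh, hhκ⟩
    have hvi := hint _ (continuous_crossQuotient (L₁ := L₁) (L₂ := L₂) hv.continuous h)
    have hFi := hint _ (continuous_crossQuotient (L₁ := L₁) (L₂ := L₂) hF h)
    have hsplit := integral_inter_add_sdiff hS.measurableSet hvi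
    set g := fun p => crossQuotient L₁ L₂ v h p - crossQuotient L₁ L₂ F h p with hg
    have hsub : ∫ p in R ∩ S, crossQuotient L₁ L₂ v h p =
        (∫ p in R ∩ S, crossQuotient L₁ L₂ F h p) + ∫ p in R ∩ S, g p := by
      rw [hg, integral_sub (hvi.mono_set inter_subset_left) (hFi.mono_set inter_subset_left)]
      abel
    -- Off `N` all three points of the quotient lie in `S`, where `v = F`, so `g` vanishes there.
    set N : Set (ℝ × ℝ) := {p | p ∈ S ∧ p + (h, 0) ∉ S} ∪ {p | p ∈ S ∧ p + (0, h) ∉ S} with hN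
    have hNvol : volume N ≤ 2 * volume (Metric.cthickening |h| S \ S) := by
      rw [two_mul]
      refine (measure_union_le _ _).trans (add_le_add ?_ ?_)
      · simpa using volume_translate_notMem_le S (h, 0)
      · simpa using volume_translate_notMem_le S (0, h)
    have hTfin : 2 * volume (Metric.cthickening |h| S \ S) ≠ ⊤ :=
      ENNReal.mul_ne_top (by simp) ((measure_mono sdiff_subset).trans_lt
        hS.isBounded.cthickening.measure_lt_top).ne
    have hSm := hS.measurableSet
    have hNm : MeasurableSet N := by
      refine MeasurableSet.union ?_ ?_
      · exact hSm.inter ((measurable_add_const ((h, 0) : ℝ × ℝ)) hSm).compl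
      · exact hSm.inter ((measurable_add_const ((0, h) : ℝ × ℝ)) hSm).compl
    have hgN : ‖∫ p in R ∩ S, g p‖ ≤
        2 * C * (2 * volume (Metric.cthickening |h| S \ S)).toReal := by
      have hzero : ∫ p in R ∩ S ∩ N, g p = ∫ p in R ∩ S, g p := by
        refine (setIntegral_eq_of_subset_of_forall_sdiff_eq_zero (hRm.inter hSm)
          inter_subset_left ?_).symm
        rintro p ⟨hp, hpN⟩
        have h1 : p + (h, 0) ∈ S := by
          by_contra hcon
          exact hpN ⟨hp, Or.inl ⟨hp.2, hcon⟩⟩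
        have h2 : p + (0, h) ∈ S := by
          by_contra hcon
          exact hpN ⟨hp, Or.inr ⟨hp.2, hcon⟩⟩
        simp only [hg, crossQuotient, hvF h1, hvF h2, hvF hp.2, sub_self]
      rw [← hzero]
      refine (norm_setIntegral_le_of_norm_le_const (C := 2 * C)
        ((measure_mono inter_subset_left).trans_lt hRS) fun p hp => ?_).trans ?_
      · rw [two_mul]
        exact (norm_sub_le _ _).trans (add_le_add (hvb h hh p) (hFb h hh hhκ p hp.1.2))
      · refine mul_le_mul_of_nonneg_left ?_ (by positivity)
        exact ENNReal.toReal_mono hTfin ((measure_mono inter_subset_right).trans hNvol)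
    have hdiff : ‖∫ p in R \ S, crossQuotient L₁ L₂ v h p‖ ≤ C * (volume (R \ S)).toReal :=
      norm_setIntegral_le_of_norm_le_const ((measure_mono sdiff_subset).trans_lt hRfin)
        fun p _ => hvb h hh p
    rw [← hsplit, hsub]
    exact (norm_add_le _ _).trans (add_le_add ((norm_add_le _ _).trans (add_le_add le_rfl hgN)) hdiff)
  have hlim := (tendsto_setIntegral_crossQuotient (L₁ := L₁) (L₂ := L₂) hv.continuous hab hcd).norm
  refine le_of_tendsto_of_tendsto hlim ?_ hbound
  simpa using (hlimF.norm.add hlimN).add_const (C * (volume (R \ S)).toReal)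

end CrossQuotient

/-! ### Rectangles all of whose sides meet the exceptional set. -/

section MinimalRectangle

open MeasureTheory intervalIntegral

variable {V : Type*} [NormedAddCommGroup V] [NormedSpace ℝ V]

/-- The open interval between `y₀` and the nearest point of `Z` in `[c, d]` avoids `Z`, and its
length is the distance to that point. If there is no such point, all of `(c, d]` avoids `Z`. -/
theorem ofReal_le_mul_volume_diff {Z : Set ℝ} (hZ : IsClosed Z) {s B y₀ c d : ℝ} (hB : 0 ≤ B)
    (hy₀ : y₀ ∈ Icc c d) (h1 : ∀ y ∈ Z ∩ Icc c d, s ≤ B * |y - y₀|) (h2 : s ≤ B * (d - c)) :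
    ENNReal.ofReal s ≤ ENNReal.ofReal B * volume (Ioc c d \ Z) := by
  rcases (Z ∩ Icc c d).eq_empty_or_nonempty with hne | hne
  · have : Ioc c d \ Z = Ioc c d := by
      refine sdiff_eq_left.2 (disjoint_left.2 fun y hy hyZ => ?_)
      have : y ∈ Z ∩ Icc c d := ⟨hyZ, Ioc_subset_Icc_self hy⟩
      simp [hne] at this
    rw [this, Real.volume_Ioc, ← ENNReal.ofReal_mul hB]
    exact ENNReal.ofReal_le_ofReal h2
  · have hcomp : IsCompact (Z ∩ Icc c d) := isCompact_Icc.inter_left hZ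
    obtain ⟨y, hy, hmin⟩ := hcomp.exists_isMinOn hne
      (f := fun y => |y - y₀|) (by fun_prop)
    have hsub : Ioo (min y y₀) (max y y₀) ⊆ Ioc c d \ Z := by
      intro t ht
      have htI : t ∈ Icc c d := ⟨(le_min hy.2.1 hy₀.1).trans ht.1.le,
        ht.2.le.trans (max_le hy.2.2 hy₀.2)⟩
      refine ⟨⟨(le_min hy.2.1 hy₀.1).trans_lt ht.1, htI.2⟩, fun htZ => ?_⟩
      have h3 : |y - y₀| ≤ |t - y₀| := hmin ⟨htZ, htI⟩
      rcases le_total y y₀ with h | h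
      · rw [min_eq_left h, max_eq_right h] at ht
        rw [abs_of_nonpos (by linarith), abs_of_nonpos (by linarith [ht.2])] at h3
        linarith [ht.1]
      · rw [min_eq_right h, max_eq_left h] at ht
        rw [abs_of_nonneg (by linarith), abs_of_nonneg (by linarith [ht.1])] at h3
        linarith [ht.2]
    refine le_trans ?_ (mul_le_mul_right (measure_mono hsub) _)
    rw [Real.volume_Ioo, max_sub_min_eq_abs', ← ENNReal.ofReal_mul hB]
    exact ENNReal.ofReal_le_ofReal (h1 y hy)

theorem lintegral_volume_slice {S : Set (ℝ × ℝ)} (hS : MeasurableSet S) (a b c d : ℝ) :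
    ∫⁻ x in Ioc a b, volume (Ioc c d \ {y | (x, y) ∈ S}) =
      volume ((Ioc a b ×ˢ Ioc c d) \ S) := by
  rw [Measure.volume_eq_prod, Measure.prod_apply
    ((measurableSet_Ioc.prod measurableSet_Ioc).diff hS), ← lintegral_indicator measurableSet_Ioc]
  refine lintegral_congr fun x => ?_
  by_cases hx : x ∈ Ioc a b
  · rw [indicator_of_mem hx]
    congr 1
    ext y
    simp [hx.1, hx.2]
  · rw [indicator_of_notMem hx, eq_comm]
    convert measure_empty (μ := (volume : Measure ℝ))
    ext y
    simp only [mem_preimage, Set.mem_sdiff, mem_prod, mem_empty_iff_false, iff_false]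
    tauto

theorem volume_swap_preimage_diff (S : Set (ℝ × ℝ)) (hS : MeasurableSet S) (a b c d : ℝ) :
    volume ((Ioc c d ×ˢ Ioc a b) \ Prod.swap ⁻¹' S) = volume ((Ioc a b ×ˢ Ioc c d) \ S) := by
  have h := (Measure.measurePreserving_swap (μ := (volume : Measure ℝ))
    (ν := (volume : Measure ℝ))).measure_preimage
    ((measurableSet_Ioc.prod measurableSet_Ioc).diff hS :
      MeasurableSet ((Ioc a b ×ˢ Ioc c d) \ S)).nullMeasurableSet
  rw [Measure.volume_eq_prod, ← h]
  congr 1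
  ext ⟨x, y⟩
  simp only [Set.mem_sdiff, mem_prod, mem_preimage, Prod.swap_prod_mk]
  tauto

/-- If `w` vanishes on the closed set `S` and grows linearly off `S` in the coordinate directions,
then its integral along a horizontal segment that meets `S` is bounded by the area off `S`. -/
theorem ofReal_norm_integral_le_volume_diff {S : Set (ℝ × ℝ)} (hS : IsClosed S)
    {w : ℝ × ℝ → V} {B κ ρ : ℝ} (hB : 0 ≤ B) (hρ : 1 ≤ ρ)
    (hx : ∀ p ∈ S, ∀ t : ℝ, |t| ≤ κ → ‖w (p + (t, 0))‖ ≤ B * |t|)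
    (hy : ∀ p ∈ S, ∀ t : ℝ, |t| ≤ κ → ‖w (p + (0, t))‖ ≤ B * |t|)
    {a b c d a₁ b₁ y₀ u : ℝ} (ha : a ≤ a₁) (hab : a₁ ≤ b₁) (hb : b₁ ≤ b) (hy₀ : y₀ ∈ Icc c d)
    (hu : u ∈ Icc a b) (huS : (u, y₀) ∈ S) (hbκ : b - a ≤ κ) (hdκ : d - c ≤ κ)
    (hρ1 : b - a ≤ ρ * (d - c)) :
    ENNReal.ofReal ‖∫ x in a₁..b₁, w (x, y₀)‖ ≤
      ENNReal.ofReal (B * ρ) * volume ((Ioc a b ×ˢ Ioc c d) \ S) := by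
  have hcd : 0 ≤ d - c := by linarith [hy₀.1, hy₀.2]
  rw [integral_of_le hab, ofReal_norm]
  refine (enorm_integral_le_lintegral_enorm _).trans ?_
  refine (lintegral_mono_set (Ioc_subset_Ioc ha hb)).trans ?_
  rw [← lintegral_volume_slice hS.measurableSet, ← lintegral_const_mul' _ _ ENNReal.ofReal_ne_top]
  refine setLIntegral_mono' measurableSet_Ioc fun x hxI => ?_
  rw [← ofReal_norm]
  -- On the vertical slice over `x`, a point of `S` controls `w (x, y₀)` by its vertical distance.
  -- If the slice misses `S`, the point `(u, y₀)` controls it horizontally, and `ρ` trades the width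
  -- for the height.
  refine ofReal_le_mul_volume_diff (hS.preimage (by fun_prop : Continuous fun y : ℝ => (x, y)))
    (by positivity) hy₀ (fun y hyS => ?_) ?_
  · have h := hy (x, y) hyS.1 (y₀ - y) ((abs_le.2 ⟨?_, ?_⟩))
    · simp only [Prod.mk_add_mk, add_zero, add_sub_cancel] at h
      rw [abs_sub_comm]
      refine h.trans (mul_le_mul_of_nonneg_right ?_ (abs_nonneg _))
      nlinarith
    · linarith [hyS.2.2, hy₀.1]
    · linarith [hyS.2.1, hy₀.2]
  · have habs : |x - u| ≤ b - a :=
      abs_le.2 ⟨by linarith [hu.2, hxI.1], by linarith [hu.1, hxI.2]⟩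
    have h := hx (u, y₀) huS (x - u) (habs.trans hbκ)
    simp only [Prod.mk_add_mk, add_zero, add_sub_cancel] at h
    calc _ ≤ B * |x - u| := h
      _ ≤ B * (ρ * (d - c)) := mul_le_mul_of_nonneg_left (habs.trans hρ1) hB
      _ = _ := by ring

theorem eq_zero_of_eqOn_Ico {V : Type*} [NormedAddCommGroup V] {φ : ℝ → V} (hφ : Continuous φ) {a b : ℝ} (hab : a ≤ b)
    (ha : φ a = 0) (h : ∀ t, a ≤ t → t < b → φ t = 0) : φ b = 0 := by
  rcases hab.eq_or_lt with rfl | hlt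
  · exact ha
  · have hcl : IsClosed {t | φ t = 0} := isClosed_eq hφ continuous_const
    have : closure (Ico a b) ⊆ {t | φ t = 0} := hcl.closure_subset_iff.2 fun t ht => h t ht.1 ht.2
    rw [closure_Ico hlt.ne] at this
    exact this (right_mem_Icc.2 hlt.le)

theorem eq_zero_of_eqOn_Ioc {V : Type*} [NormedAddCommGroup V] {φ : ℝ → V} (hφ : Continuous φ) {a b : ℝ} (hab : a ≤ b)
    (hb : φ b = 0) (h : ∀ t, a < t → t ≤ b → φ t = 0) : φ a = 0 := by
  rcases hab.eq_or_lt with rfl | hlt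
  · exact hb
  · have hcl : IsClosed {t | φ t = 0} := isClosed_eq hφ continuous_const
    have : closure (Ioc a b) ⊆ {t | φ t = 0} := hcl.closure_subset_iff.2 fun t ht => h t ht.1 ht.2
    rw [closure_Ioc hlt.ne] at this
    exact this (left_mem_Icc.2 hlt.le)

/-- A rectangle that meets the compact set `S` contains a smaller one with the same boundary
integral, all sides of which meet `S`, if the boundary integral vanishes off `S`. -/
theorem exists_rectIntegral_eq {P Q : ℝ × ℝ → V} (hP : Continuous P) (hQ : Continuous Q)
    {S : Set (ℝ × ℝ)} (hS : IsClosed S) {a b c d : ℝ}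
    (hzero : ∀ a' b' c' d', a ≤ a' → a' ≤ b' → b' ≤ b → c ≤ c' → c' ≤ d' → d' ≤ d →
      Disjoint (Icc a' b' ×ˢ Icc c' d') S → rectIntegral P Q a' b' c' d' = 0)
    (hne : (Icc a b ×ˢ Icc c d ∩ S).Nonempty) :
    ∃ a₁ b₁ c₁ d₁, a ≤ a₁ ∧ a₁ ≤ b₁ ∧ b₁ ≤ b ∧ c ≤ c₁ ∧ c₁ ≤ d₁ ∧ d₁ ≤ d ∧
      (∃ y ∈ Icc c d, (a₁, y) ∈ S) ∧ (∃ y ∈ Icc c d, (b₁, y) ∈ S) ∧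
      (∃ x ∈ Icc a b, (x, c₁) ∈ S) ∧ (∃ x ∈ Icc a b, (x, d₁) ∈ S) ∧
      rectIntegral P Q a b c d = rectIntegral P Q a₁ b₁ c₁ d₁ := by
  have hT : IsCompact (Icc a b ×ˢ Icc c d ∩ S) := (isCompact_Icc.prod isCompact_Icc).inter_right hS
  -- The smaller rectangle is the bounding box of the part of `S` in the given one.
  obtain ⟨pa, hpa, ha⟩ := hT.exists_isMinOn hne continuous_fst.continuousOn
  obtain ⟨pb, hpb, hb⟩ := hT.exists_isMaxOn hne continuous_fst.continuousOn
  obtain ⟨pc, hpc, hc⟩ := hT.exists_isMinOn hne continuous_snd.continuousOn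
  obtain ⟨pd, hpd, hd⟩ := hT.exists_isMaxOn hne continuous_snd.continuousOn
  have hab : pa.1 ≤ pb.1 := ha hpb
  have hcd : pc.2 ≤ pd.2 := hc hpd
  obtain ⟨⟨⟨pa1, pa2⟩, pa3, pa4⟩, pa5⟩ := hpa
  obtain ⟨⟨⟨pb1, pb2⟩, pb3, pb4⟩, pb5⟩ := hpb
  obtain ⟨⟨⟨pc1, pc2⟩, pc3, pc4⟩, pc5⟩ := hpc
  obtain ⟨⟨⟨pd1, pd2⟩, pd3, pd4⟩, pd5⟩ := hpd
  refine ⟨pa.1, pb.1, pc.2, pd.2, pa1, hab, pb2, pc3, hcd, pd4, ⟨pa.2, ⟨pa3, pa4⟩, pa5⟩,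
    ⟨pb.2, ⟨pb3, pb4⟩, pb5⟩, ⟨pc.1, ⟨pc1, pc2⟩, pc5⟩, ⟨pd.1, ⟨pd1, pd2⟩, pd5⟩, ?_⟩
  have hcd' : c ≤ d := pa3.trans pa4
  -- The strip up to `pa.1` touches `S`, but every narrower one avoids it, so continuity gives the
  -- limiting case. The other three strips are treated in the same way.
  have e1 : rectIntegral P Q a pa.1 c d = 0 := by
    refine eq_zero_of_eqOn_Ico (φ := fun t => rectIntegral P Q a t c d)
      (continuous_rectIntegral hP hQ continuous_const continuous_id continuous_const
        continuous_const) pa1 (rectIntegral_self_left _ _ _ _ _) fun t ht1 ht2 => ?_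
    refine hzero _ _ _ _ le_rfl ht1 (ht2.le.trans pa2) le_rfl hcd' le_rfl
      (disjoint_left.2 fun q hq hqS => ?_)
    have : pa.1 ≤ q.1 := ha ⟨⟨⟨hq.1.1, hq.1.2.trans (ht2.le.trans pa2)⟩, hq.2⟩, hqS⟩
    linarith [hq.1.2]
  have e2 : rectIntegral P Q pb.1 b c d = 0 := by
    refine eq_zero_of_eqOn_Ioc (φ := fun t => rectIntegral P Q t b c d)
      (continuous_rectIntegral hP hQ continuous_id continuous_const continuous_const
        continuous_const) pb2 (rectIntegral_self_left _ _ _ _ _) fun t ht1 ht2 => ?_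
    refine hzero _ _ _ _ (pb1.trans ht1.le) ht2 le_rfl le_rfl hcd' le_rfl
      (disjoint_left.2 fun q hq hqS => ?_)
    have : q.1 ≤ pb.1 := hb ⟨⟨⟨pb1.trans (ht1.le.trans hq.1.1), hq.1.2⟩, hq.2⟩, hqS⟩
    linarith [hq.1.1]
  have e3 : rectIntegral P Q pa.1 pb.1 c pc.2 = 0 := by
    refine eq_zero_of_eqOn_Ico (φ := fun t => rectIntegral P Q pa.1 pb.1 c t)
      (continuous_rectIntegral hP hQ continuous_const continuous_const continuous_const
        continuous_id) pc3 (rectIntegral_self_right _ _ _ _ _) fun t ht1 ht2 => ?_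
    refine hzero _ _ _ _ pa1 hab pb2 le_rfl ht1 (ht2.le.trans pc4)
      (disjoint_left.2 fun q hq hqS => ?_)
    have : pc.2 ≤ q.2 := hc ⟨⟨⟨pa1.trans hq.1.1, hq.1.2.trans pb2⟩,
      ⟨hq.2.1, hq.2.2.trans (ht2.le.trans pc4)⟩⟩, hqS⟩
    linarith [hq.2.2]
  have e4 : rectIntegral P Q pa.1 pb.1 pd.2 d = 0 := by
    refine eq_zero_of_eqOn_Ioc (φ := fun t => rectIntegral P Q pa.1 pb.1 t d)
      (continuous_rectIntegral hP hQ continuous_const continuous_const continuous_id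
        continuous_const) pd4 (rectIntegral_self_right _ _ _ _ _) fun t ht1 ht2 => ?_
    refine hzero _ _ _ _ pa1 hab pb2 (pd3.trans ht1.le) ht2 le_rfl
      (disjoint_left.2 fun q hq hqS => ?_)
    have : q.2 ≤ pd.2 := hd ⟨⟨⟨pa1.trans hq.1.1, hq.1.2.trans pb2⟩,
      ⟨pd3.trans (ht1.le.trans hq.2.1), hq.2.2⟩⟩, hqS⟩
    linarith [hq.2.1]
  rw [← rectIntegral_add_left hP hQ a pa.1 b, e1, zero_add,
    ← rectIntegral_add_left hP hQ pa.1 pb.1 b, e2, add_zero,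
    ← rectIntegral_add_right hP hQ _ _ c pc.2 d, e3, zero_add,
    ← rectIntegral_add_right hP hQ _ _ pc.2 pd.2 d, e4, add_zero]

end MinimalRectangle

/-! ### The area estimate and its summation over small rectangles. -/

section LoomanMenchoff

open MeasureTheory intervalIntegral

variable {V : Type*} [NormedAddCommGroup V] [NormedSpace ℝ V]

theorem volume_Ioc_prod_Ioc_lt_top (a b c d : ℝ) : volume (Ioc a b ×ˢ Ioc c d) < ⊤ :=
  (measure_mono (Set.prod_mono Ioc_subset_Icc_self Ioc_subset_Icc_self)).trans_lt
    ((isCompact_Icc.prod isCompact_Icc : IsCompact (Icc a b ×ˢ Icc c d)).measure_lt_top)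

theorem rectIntegral_sub_apply {L₁ L₂ : V →L[ℝ] V} {F v : ℝ × ℝ → V} (hF : Continuous F)
    (hv : Continuous v) (a b c d : ℝ) :
    rectIntegral (fun p => L₁ (F p)) (fun p => L₂ (F p)) a b c d -
      rectIntegral (fun p => L₁ (v p)) (fun p => L₂ (v p)) a b c d =
      rectIntegral (fun p => L₁ (F p - v p)) (fun p => L₂ (F p - v p)) a b c d := by
  unfold rectIntegral
  rw [add_sub_add_comm, ← intervalIntegral.integral_sub, ← intervalIntegral.integral_sub]
  · congr 1 <;> refine integral_congr fun t _ => ?_ <;> simp only [map_sub] <;> abel_nf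
  all_goals exact Continuous.intervalIntegrable (by fun_prop) _ _

theorem norm_rectIntegral_apply_le [CompleteSpace V] {L₁ L₂ : V →L[ℝ] V} {w : ℝ × ℝ → V}
    (hw : Continuous w) {a b c d K : ℝ} (h1 : ‖∫ x in a..b, w (x, c)‖ ≤ K)
    (h2 : ‖∫ x in a..b, w (x, d)‖ ≤ K) (h3 : ‖∫ y in c..d, w (b, y)‖ ≤ K)
    (h4 : ‖∫ y in c..d, w (a, y)‖ ≤ K) :
    ‖rectIntegral (fun p => L₁ (w p)) (fun p => L₂ (w p)) a b c d‖ ≤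
      2 * (‖L₁‖ + ‖L₂‖) * K := by
  have key : ∀ (L : V →L[ℝ] V) (u u' : ℝ → V) (s t : ℝ), Continuous u → Continuous u' →
      ‖∫ x in s..t, u x‖ ≤ K → ‖∫ x in s..t, u' x‖ ≤ K →
      ‖∫ x in s..t, (L (u x) - L (u' x))‖ ≤ 2 * ‖L‖ * K := by
    intro L u u' s t hu hu' hK hK'
    rw [integral_sub (Continuous.intervalIntegrable (by fun_prop) _ _)
      (Continuous.intervalIntegrable (by fun_prop) _ _),
      L.intervalIntegral_comp_comm (hu.intervalIntegrable _ _),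
      L.intervalIntegral_comp_comm (hu'.intervalIntegrable _ _)]
    refine (norm_sub_le _ _).trans ?_
    have e1 := (L.le_opNorm _).trans (mul_le_mul_of_nonneg_left hK (norm_nonneg L))
    have e2 := (L.le_opNorm _).trans (mul_le_mul_of_nonneg_left hK' (norm_nonneg L))
    linarith
  unfold rectIntegral
  refine (norm_add_le _ _).trans ?_
  have e1 := key L₁ (fun x => w (x, c)) (fun x => w (x, d)) a b (by fun_prop) (by fun_prop) h1 h2
  have e2 := key L₂ (fun y => w (b, y)) (fun y => w (a, y)) c d (by fun_prop) (by fun_prop) h3 h4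
  linarith

/-- If `F` agrees with a Lipschitz function `v` on the compact set `S`, where the form
`L₁ F dx + L₂ F dy` is pointwise closed, and is closed off `S`, then its integral along the
boundary of a rectangle is bounded by the area of the rectangle off `S`. -/
theorem norm_rectIntegral_le_volume_diff [CompleteSpace V] {L₁ L₂ : V →L[ℝ] V} {F v : ℝ × ℝ → V}
    (hF : Continuous F) {M : NNReal} (hv : LipschitzWith M v)
    {S : Set (ℝ × ℝ)} (hS : IsCompact S) (hvF : EqOn v F S) {κ : ℝ} (hκ : 0 < κ)
    (hx : ∀ p ∈ S, ∀ t : ℝ, |t| ≤ κ → ‖F (p + (t, 0)) - F p‖ ≤ M * |t|)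
    (hy : ∀ p ∈ S, ∀ t : ℝ, |t| ≤ κ → ‖F (p + (0, t)) - F p‖ ≤ M * |t|)
    (hder : ∀ p ∈ S, Tendsto (fun h => crossQuotient L₁ L₂ F h p) (𝓝[≠] 0) (𝓝 0))
    {a b c d ρ : ℝ} (hρ : 1 ≤ ρ)
    (hzero : ∀ a' b' c' d', a ≤ a' → a' ≤ b' → b' ≤ b → c ≤ c' → c' ≤ d' → d' ≤ d →
      Disjoint (Icc a' b' ×ˢ Icc c' d') S →
      rectIntegral (fun p => L₁ (F p)) (fun p => L₂ (F p)) a' b' c' d' = 0)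
    (hne : (Icc a b ×ˢ Icc c d ∩ S).Nonempty) (hbκ : b - a ≤ κ) (hdκ : d - c ≤ κ)
    (hρ1 : b - a ≤ ρ * (d - c)) (hρ2 : d - c ≤ ρ * (b - a)) :
    ‖rectIntegral (fun p => L₁ (F p)) (fun p => L₂ (F p)) a b c d‖ ≤
      (‖L₁‖ + ‖L₂‖) * M * (1 + 4 * ρ) * (volume ((Ioc a b ×ˢ Ioc c d) \ S)).toReal := by
  obtain ⟨a₁, b₁, c₁, d₁, ha, hab, hb, hc, hcd, hd, ⟨ya, hya, hyaS⟩, ⟨yb, hyb, hybS⟩,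
    ⟨xc, hxc, hxcS⟩, ⟨xd, hxd, hxdS⟩, heq⟩ := exists_rectIntegral_eq
      (P := fun p => L₁ (F p)) (Q := fun p => L₂ (F p)) (by fun_prop) (by fun_prop)
      hS.isClosed hzero hne
  set m := (volume ((Ioc a b ×ˢ Ioc c d) \ S)).toReal with hm
  have hfin : volume ((Ioc a b ×ˢ Ioc c d) \ S) ≠ ⊤ :=
    ((measure_mono sdiff_subset).trans_lt (volume_Ioc_prod_Ioc_lt_top a b c d)).ne
  have hvc := hv.continuous
  -- The difference `w` vanishes on `S`, and both terms vary by at most `M |t|` from there, whence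
  -- the growth constant `2 * M`.
  set w := fun p => F p - v p with hw
  have hwx : ∀ p ∈ S, ∀ t : ℝ, |t| ≤ κ → ‖w (p + (t, 0))‖ ≤ 2 * M * |t| := by
    intro p hp t ht
    have e1 := hx p hp t ht
    have e2 := hv.norm_sub_le p (p + (t, 0))
    have : w (p + (t, 0)) = (F (p + (t, 0)) - F p) + (v p - v (p + (t, 0))) := by
      simp only [hw, hvF hp]; abel
    rw [this]
    refine (norm_add_le _ _).trans ?_
    simp at e2
    linarith
  have hwy : ∀ p ∈ S, ∀ t : ℝ, |t| ≤ κ → ‖w (p + (0, t))‖ ≤ 2 * M * |t| := by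
    intro p hp t ht
    have e1 := hy p hp t ht
    have e2 := hv.norm_sub_le p (p + (0, t))
    have : w (p + (0, t)) = (F (p + (0, t)) - F p) + (v p - v (p + (0, t))) := by
      simp only [hw, hvF hp]; abel
    rw [this]
    refine (norm_add_le _ _).trans ?_
    simp at e2
    linarith
  have toR : ∀ s : ℝ, ENNReal.ofReal s ≤ ENNReal.ofReal (2 * M * ρ) *
      volume ((Ioc a b ×ˢ Ioc c d) \ S) → s ≤ 2 * M * ρ * m := by
    intro s hs
    rw [ENNReal.ofReal_le_iff_le_toReal (ENNReal.mul_ne_top ENNReal.ofReal_ne_top hfin),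
      ENNReal.toReal_mul, ENNReal.toReal_ofReal (by positivity)] at hs
    exact hs
  have hor : ∀ y₀ u, y₀ ∈ Icc c d → u ∈ Icc a b → (u, y₀) ∈ S →
      ‖∫ x in a₁..b₁, w (x, y₀)‖ ≤ 2 * M * ρ * m := fun y₀ u h1 h2 h3 =>
    toR _ (ofReal_norm_integral_le_volume_diff hS.isClosed (by positivity) hρ hwx hwy ha hab hb
      h1 h2 h3 hbκ hdκ hρ1)
  have ver : ∀ x₀ u, x₀ ∈ Icc a b → u ∈ Icc c d → (x₀, u) ∈ S →
      ‖∫ y in c₁..d₁, w (x₀, y)‖ ≤ 2 * M * ρ * m := fun x₀ u h1 h2 h3 => by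
    refine toR _ ?_
    rw [← volume_swap_preimage_diff _ hS.measurableSet]
    exact ofReal_norm_integral_le_volume_diff (S := Prod.swap ⁻¹' S) (w := fun p => w p.swap)
      (hS.isClosed.preimage continuous_swap) (by positivity) hρ (fun p hp t ht => hwy _ hp t ht)
      (fun p hp t ht => hwx _ hp t ht) hc hcd hd h1 h2 h3 hdκ hbκ hρ2
  have hGw := norm_rectIntegral_apply_le (L₁ := L₁) (L₂ := L₂) (w := w) (by fun_prop)
    (hor c₁ xc ⟨hc, hcd.trans hd⟩ hxc hxcS) (hor d₁ xd ⟨hc.trans hcd, hd⟩ hxd hxdS)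
    (ver b₁ yb ⟨ha.trans hab, hb⟩ hyb hybS) (ver a₁ ya ⟨ha, hab.trans hb⟩ hya hyaS)
  have hGv := norm_rectIntegral_le_of_lipschitz (L₁ := L₁) (L₂ := L₂) hF hv hS hvF hκ hx hy hder
    hab hcd
  have hmono : (volume ((Ioc a₁ b₁ ×ˢ Ioc c₁ d₁) \ S)).toReal ≤ m :=
    ENNReal.toReal_mono hfin (measure_mono (sdiff_subset_sdiff_left
      (Set.prod_mono (Ioc_subset_Ioc ha hb) (Ioc_subset_Ioc hc hd))))
  have hsum := rectIntegral_sub_apply (L₁ := L₁) (L₂ := L₂) hF hvc a₁ b₁ c₁ d₁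
  rw [heq, sub_eq_iff_eq_add.1 hsum]
  -- In the factor `1 + 4 * ρ` the `1` comes from `v`, and `4 * ρ` from the four sides, each
  -- bounding the integral of `w` by `2 * M * ρ * m`.
  refine (norm_add_le _ _).trans ?_
  have : (‖L₁‖ + ‖L₂‖) * M * (volume ((Ioc a₁ b₁ ×ˢ Ioc c₁ d₁) \ S)).toReal ≤
    (‖L₁‖ + ‖L₂‖) * M * m := mul_le_mul_of_nonneg_left hmono (by positivity)
  linarith

/-- Cut the rectangle into small similar ones. Those that miss `S` contribute nothing, and those
that meet `S` lie in a thin thickening of it, so the total is at most `C` times the area of the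
shell around `S`, which tends to zero. Similarity of the pieces is what lets one constant `C` serve
for all of them. -/
theorem rectIntegral_eq_zero_of_le_volume_diff {P Q : ℝ × ℝ → V} (hP : Continuous P)
    (hQ : Continuous Q) {S : Set (ℝ × ℝ)} (hS : IsCompact S) {a b c d C : ℝ} (hab : a < b)
    (hcd : c < d) (hC : 0 ≤ C)
    (hzero : ∀ a' b' c' d', a ≤ a' → a' ≤ b' → b' ≤ b → c ≤ c' → c' ≤ d' → d' ≤ d →
      Disjoint (Icc a' b' ×ˢ Icc c' d') S → rectIntegral P Q a' b' c' d' = 0)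
    (hle : ∀ a' b' c' d', a ≤ a' → a' ≤ b' → b' ≤ b → c ≤ c' → c' ≤ d' → d' ≤ d →
      (Icc a' b' ×ˢ Icc c' d' ∩ S).Nonempty → (b' - a') * (d - c) = (d' - c') * (b - a) →
      ‖rectIntegral P Q a' b' c' d'‖ ≤ C * (volume ((Ioc a' b' ×ˢ Ioc c' d') \ S)).toReal) :
    rectIntegral P Q a b c d = 0 := by
  have hδ : ∀ δ > 0, ‖rectIntegral P Q a b c d‖ ≤
      C * (volume (Metric.cthickening δ S \ S)).toReal := by
    intro δ hδ
    set T := Metric.cthickening δ S \ S with hT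
    have hTm : MeasurableSet T := Metric.isClosed_cthickening.measurableSet.diff hS.measurableSet
    have hTfin : volume T ≠ ⊤ := ((measure_mono sdiff_subset).trans_lt
        hS.isBounded.cthickening.measure_lt_top).ne
    have hfin : ∀ A, volume (A ∩ T) ≠ ⊤ := fun A =>
      ((measure_mono inter_subset_right).trans_lt hTfin.lt_top).ne
    obtain ⟨m1, hm1⟩ := exists_div_two_pow_lt (b - a) hδ
    obtain ⟨m2, hm2⟩ := exists_div_two_pow_lt (d - c) hδ
    have e1 := hm1 (max m1 m2) (le_max_left _ _)
    have e2 := hm2 (max m1 m2) (le_max_right _ _)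
    have := rect_induction (p := fun a b c d => ‖rectIntegral P Q a b c d‖ ≤
      C * (volume ((Ioc a b ×ˢ Ioc c d) ∩ T)).toReal) ?_ (max m1 m2) hab.le hcd.le ?_
    · exact this.trans (mul_le_mul_of_nonneg_left
        (ENNReal.toReal_mono hTfin (measure_mono inter_subset_right)) hC)
    · intro a b c d hab hcd h1 h2 h3 h4
      have hx1 : a ≤ (a + b) / 2 := by linarith
      have hx2 : (a + b) / 2 ≤ b := by linarith
      have hy1 : c ≤ (c + d) / 2 := by linarith
      have hy2 : (c + d) / 2 ≤ d := by linarith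
      rw [rectIntegral_quarters hP hQ a ((a + b) / 2) b c ((c + d) / 2) d]
      have splitX : ∀ c d, (volume ((Ioc a b ×ˢ Ioc c d) ∩ T)).toReal =
          (volume ((Ioc a ((a + b) / 2) ×ˢ Ioc c d) ∩ T)).toReal +
          (volume ((Ioc ((a + b) / 2) b ×ˢ Ioc c d) ∩ T)).toReal := by
        intro c d
        rw [← ENNReal.toReal_add (hfin _) (hfin _), ← measure_union, ← union_inter_distrib_right,
          ← union_prod, Ioc_union_Ioc_eq_Ioc hx1 hx2]
        · refine Disjoint.mono inter_subset_left inter_subset_left (Disjoint.set_prod_left ?_ _ _)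
          exact Ioc_disjoint_Ioc_of_le le_rfl
        · exact (measurableSet_Ioc.prod measurableSet_Ioc).inter hTm
      have splitY : (volume ((Ioc a b ×ˢ Ioc c d) ∩ T)).toReal =
          (volume ((Ioc a b ×ˢ Ioc c ((c + d) / 2)) ∩ T)).toReal +
          (volume ((Ioc a b ×ˢ Ioc ((c + d) / 2) d) ∩ T)).toReal := by
        rw [← ENNReal.toReal_add (hfin _) (hfin _), ← measure_union, ← union_inter_distrib_right,
          ← prod_union, Ioc_union_Ioc_eq_Ioc hy1 hy2]
        · refine Disjoint.mono inter_subset_left inter_subset_left (Disjoint.set_prod_right ?_ _ _)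
          exact Ioc_disjoint_Ioc_of_le le_rfl
        · exact (measurableSet_Ioc.prod measurableSet_Ioc).inter hTm
      rw [splitY, splitX, splitX]
      refine (norm_add_le _ _).trans ((add_le_add ((norm_add_le _ _).trans
        (add_le_add ((norm_add_le _ _).trans (add_le_add h1 h2)) h3)) h4).trans_eq ?_)
      ring
    · intro a' b' c' d' h1 h2 h3 h4 h5 h6 h7 h8
      rcases (Icc a' b' ×ˢ Icc c' d' ∩ S).eq_empty_or_nonempty with hne | hne
      · rw [hzero a' b' c' d' h1 h2 h3 h4 h5 h6 (disjoint_iff_inter_eq_empty.2 hne), norm_zero]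
        positivity
      · refine (hle a' b' c' d' h1 h2 h3 h4 h5 h6 hne ?_).trans
          (mul_le_mul_of_nonneg_left (ENNReal.toReal_mono (hfin _) (measure_mono ?_)) hC)
        · rw [h7, h8]; ring
        · rintro p ⟨hp, hpS⟩
          obtain ⟨q, hq, hqS⟩ := hne
          refine ⟨hp, Metric.mem_cthickening_of_dist_le _ q _ _ hqS ?_, hpS⟩
          rw [Prod.dist_eq, Real.dist_eq, Real.dist_eq]
          refine max_le (abs_le.2 ⟨?_, ?_⟩) (abs_le.2 ⟨?_, ?_⟩) <;>
            linarith [hp.1.1, hp.1.2, hp.2.1, hp.2.2, hq.1.1, hq.1.2, hq.2.1, hq.2.2]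
  have hlim : Tendsto (fun δ => C * (volume (Metric.cthickening δ S \ S)).toReal) (𝓝[>] 0)
      (𝓝 (C * 0)) := by
    refine Tendsto.const_mul C ?_
    have := (ENNReal.tendsto_toReal ENNReal.zero_ne_top).comp (tendsto_volume_cthickening_diff hS)
    exact (this.mono_left nhdsWithin_le_nhds)
  rw [mul_zero] at hlim
  exact norm_le_zero_iff.1 (ge_of_tendsto hlim (eventually_mem_nhdsWithin.mono hδ))

end LoomanMenchoff

/-! ### The category argument. -/

section Baire

open MeasureTheory

variable {V : Type*} [NormedAddCommGroup V] [NormedSpace ℝ V]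

/-- A single integer governs both the slope and the reciprocal of the radius, so that countably many
closed conditions exhaust all points. -/
theorem HasDerivAt.exists_nat_lipschitz_bound {u : ℝ → V} {A : V} (h : HasDerivAt u A 0) :
    ∃ n : ℕ, ∀ m ≥ n, ∀ t : ℝ, |t| ≤ 1 / ((m : ℝ) + 1) → ‖u t - u 0‖ ≤ (m + 1) * |t| := by
  obtain ⟨C, hC⟩ := h.isBigO_sub.bound
  obtain ⟨ε, hε, hball⟩ := Metric.eventually_nhds_iff.1 hC
  obtain ⟨n1, hn1⟩ := exists_nat_gt C
  obtain ⟨n2, hn2⟩ := exists_nat_one_div_lt hε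
  refine ⟨max n1 n2, fun m hm t ht => ?_⟩
  have hm1 : (n1 : ℝ) ≤ m := by exact_mod_cast (le_max_left _ _).trans hm
  have hm2 : (n2 : ℝ) ≤ m := by exact_mod_cast (le_max_right _ _).trans hm
  have hlt : |t| < ε := ht.trans_lt ((one_div_le_one_div_of_le (by positivity)
    (by linarith)).trans_lt hn2)
  have := hball (y := t) (by simpa using hlt)
  refine this.trans ?_
  rw [sub_zero, Real.norm_eq_abs]
  exact mul_le_mul_of_nonneg_right (by linarith) (abs_nonneg _)

theorem tendsto_crossQuotient {L₁ L₂ : V →L[ℝ] V} {F : ℝ × ℝ → V} {p : ℝ × ℝ} {A B : V}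
    (hA : HasDerivAt (fun t : ℝ => F (p + (t, 0))) A 0)
    (hB : HasDerivAt (fun t : ℝ => F (p + (0, t))) B 0) (h : L₂ A = L₁ B) :
    Tendsto (fun h => crossQuotient L₁ L₂ F h p) (𝓝[≠] 0) (𝓝 0) := by
  have h1 := (L₂.continuous.tendsto _).comp hA.tendsto_slope_zero
  have h2 := (L₁.continuous.tendsto _).comp hB.tendsto_slope_zero
  have h3 := h1.sub h2
  rw [h, sub_self] at h3
  refine h3.congr fun t => ?_
  have h0 : p + ((0 : ℝ), (0 : ℝ)) = p := add_zero p
  simp [crossQuotient, h0]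

/-- **Looman–Menchoff theorem** for rectangles: the form `L₁ F dx + L₂ F dy` is closed if `F` is
continuous, has partial derivatives everywhere, and `∂ₓ (L₂ F) = ∂ᵧ (L₁ F)`. -/
theorem rectIntegral_eq_zero_of_partialDeriv [FiniteDimensional ℝ V] {L₁ L₂ : V →L[ℝ] V}
    {F : ℝ × ℝ → V} (hF : Continuous F) {U : Set (ℝ × ℝ)} (hU : IsOpen U)
    (hder : ∀ p ∈ U, ∃ A B, HasDerivAt (fun t : ℝ => F (p + (t, 0))) A 0 ∧
      HasDerivAt (fun t : ℝ => F (p + (0, t))) B 0 ∧ L₂ A = L₁ B)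
    {a b c d : ℝ} (hab : a ≤ b) (hcd : c ≤ d) (hR : Icc a b ×ˢ Icc c d ⊆ U) :
    rectIntegral (fun p => L₁ (F p)) (fun p => L₂ (F p)) a b c d = 0 := by
  have : CompleteSpace V := FiniteDimensional.complete ℝ V
  have hP : Continuous fun p => L₁ (F p) := by fun_prop
  have hQ : Continuous fun p => L₂ (F p) := by fun_prop
  set O : Set (ℝ × ℝ) := {q | ∃ r > 0, ∀ a b c d, a ≤ b → c ≤ d →
    Icc a b ×ˢ Icc c d ⊆ Metric.ball q r →
    rectIntegral (fun p => L₁ (F p)) (fun p => L₂ (F p)) a b c d = 0} with hO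
  have hOopen : IsOpen O := by
    rw [Metric.isOpen_iff]
    rintro q ⟨r, hr, hq⟩
    refine ⟨r / 2, by positivity, fun q' hq' => ⟨r / 2, by positivity, fun a b c d h1 h2 h3 =>
      hq a b c d h1 h2 (h3.trans (Metric.ball_subset_ball' ?_))⟩⟩
    linarith [Metric.mem_ball.1 hq']
  by_cases hUO : U ⊆ O
  · exact rectIntegral_eq_zero_of_locally hP hQ (fun q hq => hq) hab hcd (hR.trans hUO)
  exfalso
  obtain ⟨q₀, hq₀U, hq₀O⟩ := not_subset.1 hUO
  -- The exceptional set is locally closed, hence locally compact in its own right, so Baire's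
  -- theorem applies to it as a space.
  set E : Set (ℝ × ℝ) := U ∩ Oᶜ with hE
  have hEl : IsLocallyClosed E := hU.isLocallyClosed.inter hOopen.isClosed_compl.isLocallyClosed
  have : LocallyCompactSpace E := hEl.locallyCompactSpace
  have : Nonempty E := ⟨⟨q₀, hq₀U, hq₀O⟩⟩
  let W : ℕ → Set E := fun n => {p | ∀ t : ℝ, |t| ≤ 1 / ((n : ℝ) + 1) →
    ‖F ((p : ℝ × ℝ) + (t, 0)) - F p‖ ≤ (n + 1) * |t| ∧
    ‖F ((p : ℝ × ℝ) + (0, t)) - F p‖ ≤ (n + 1) * |t|}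
  have hWc : ∀ n, IsClosed (W n) := fun n => by
    simp only [W, Set.ofPred_forall, Set.ofPred_and]
    refine isClosed_iInter fun t => isClosed_iInter fun _ => IsClosed.inter ?_ ?_ <;>
      exact isClosed_le (by fun_prop) continuous_const
  have hWu : ⋃ n, W n = univ := by
    refine eq_univ_of_forall fun p => ?_
    obtain ⟨A, B, hA, hB, -⟩ := hder p p.2.1
    obtain ⟨n1, hn1⟩ := hA.exists_nat_lipschitz_bound
    obtain ⟨n2, hn2⟩ := hB.exists_nat_lipschitz_bound
    have h0 : (p : ℝ × ℝ) + ((0 : ℝ), (0 : ℝ)) = p := add_zero _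
    refine mem_iUnion.2 ⟨max n1 n2, fun t ht => ⟨?_, ?_⟩⟩
    · simpa [h0] using hn1 _ (le_max_left _ _) t ht
    · simpa [h0] using hn2 _ (le_max_right _ _) t ht
  obtain ⟨n, p₀, hp₀⟩ := nonempty_interior_of_iUnion_of_closed hWc hWu
  obtain ⟨ε₁, hε₁, hball₁⟩ := Metric.mem_nhds_iff.1 (mem_interior_iff_mem_nhds.1 hp₀)
  obtain ⟨ε₂, hε₂, hball₂⟩ := Metric.isOpen_iff.1 hU p₀ p₀.2.1
  set κ : ℝ := 1 / ((n : ℝ) + 1) with hκdef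
  have hκ : 0 < κ := by positivity
  -- The strict bounds put the closed ball into both open balls. By `2 * r ≤ κ`, any two of its
  -- points are within the range `κ` of the increment bounds.
  obtain ⟨r, hr, hrε₁, hrε₂, hrκ⟩ : ∃ r > 0, r < ε₁ ∧ r < ε₂ ∧ 2 * r ≤ κ := by
    refine ⟨min (min ε₁ ε₂) κ / 2, by positivity, ?_, ?_, ?_⟩
    · have := (min_le_left (min ε₁ ε₂) κ).trans (min_le_left _ _); linarith
    · have := (min_le_left (min ε₁ ε₂) κ).trans (min_le_right _ _); linarith
    · have := min_le_right (min ε₁ ε₂) κ; linarith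
  have hrU : Metric.closedBall (p₀ : ℝ × ℝ) r ⊆ U :=
    (Metric.closedBall_subset_ball hrε₂).trans hball₂
  set S : Set (ℝ × ℝ) := Metric.closedBall (p₀ : ℝ × ℝ) r ∩ Oᶜ with hSdef
  have hS : IsCompact S := (isCompact_closedBall _ _).inter_right hOopen.isClosed_compl
  have hSW : ∀ p ∈ S, ∀ t : ℝ, |t| ≤ κ → ‖F (p + (t, 0)) - F p‖ ≤ (n + 1) * |t| ∧
      ‖F (p + (0, t)) - F p‖ ≤ (n + 1) * |t| := by
    intro p hp
    have hpE : p ∈ E := ⟨hrU hp.1, hp.2⟩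
    exact @hball₁ ⟨p, hpE⟩ (Metric.mem_ball.2 ((Metric.mem_closedBall.1 hp.1).trans_lt hrε₁))
  have hSlip : LipschitzOnWith (2 * (n + 1)) F S := by
    refine LipschitzOnWith.of_dist_le_mul fun p hp q hq => ?_
    have h1 : dist p q ≤ κ := by
      have e1 := Metric.mem_closedBall.1 hp.1
      have e2 := Metric.mem_closedBall'.1 hq.1
      linarith [dist_triangle p (p₀ : ℝ × ℝ) q]
    have hd1 : |q.1 - p.1| ≤ dist p q := by
      rw [dist_comm, Prod.dist_eq, Real.dist_eq]; exact le_max_left _ _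
    have hd2 : |p.2 - q.2| ≤ dist p q := by
      rw [Prod.dist_eq, Real.dist_eq, Real.dist_eq]; exact le_max_right _ _
    have f1 := (hSW p hp (q.1 - p.1) (hd1.trans h1)).1
    have f2 := (hSW q hq (p.2 - q.2) (hd2.trans h1)).2
    -- The points `p` and `q` are joined through the corner `(q.1, p.2)`, which need not lie in `S`:
    -- each leg is estimated from its endpoint in `S`.
    have c1 : p + (q.1 - p.1, 0) = (q.1, p.2) := by ext <;> simp
    have c2 : q + (0, p.2 - q.2) = (q.1, p.2) := by ext <;> simp
    rw [c1] at f1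
    rw [c2] at f2
    rw [dist_eq_norm]
    have : F p - F q = (F (q.1, p.2) - F q) - (F (q.1, p.2) - F p) := by abel
    rw [this]
    refine (norm_sub_le _ _).trans ((add_le_add f2 f1).trans ?_)
    have hn : (0 : ℝ) ≤ n + 1 := by positivity
    have g1 := mul_le_mul_of_nonneg_left hd1 hn
    have g2 := mul_le_mul_of_nonneg_left hd2 hn
    push_cast
    linarith
  -- The extension to the whole plane costs a constant depending on `V`; `M` is enlarged so as to
  -- bound also the increments of `F` from points of `S`.
  obtain ⟨v, hv, hvF⟩ := hSlip.extend_finite_dimension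
  set M : NNReal := max (lipschitzExtensionConstant V * (2 * (n + 1))) (n + 1) with hM
  have hvM : LipschitzWith M v := hv.weaken (le_max_left _ _)
  have hnM : (n + 1 : ℝ) ≤ M := by
    have : ((n + 1 : NNReal) : ℝ) ≤ M := NNReal.coe_le_coe.2 (le_max_right _ _)
    simpa using this
  have hx : ∀ p ∈ S, ∀ t : ℝ, |t| ≤ κ → ‖F (p + (t, 0)) - F p‖ ≤ M * |t| := fun p hp t ht =>
    (hSW p hp t ht).1.trans (mul_le_mul_of_nonneg_right hnM (abs_nonneg _))
  have hy : ∀ p ∈ S, ∀ t : ℝ, |t| ≤ κ → ‖F (p + (0, t)) - F p‖ ≤ M * |t| := fun p hp t ht =>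
    (hSW p hp t ht).2.trans (mul_le_mul_of_nonneg_right hnM (abs_nonneg _))
  have hSder : ∀ p ∈ S, Tendsto (fun h => crossQuotient L₁ L₂ F h p) (𝓝[≠] 0) (𝓝 0) := by
    intro p hp
    obtain ⟨A, B, hA, hB, hAB⟩ := hder p (hrU hp.1)
    exact tendsto_crossQuotient hA hB hAB
  -- The contradiction is that `p₀` turns out to lie in `O`.
  refine p₀.2.2 ⟨r, hr, fun a b c d hab hcd hball => ?_⟩
  rcases hab.eq_or_lt with rfl | hab
  · exact rectIntegral_self_left _ _ _ _ _
  rcases hcd.eq_or_lt with rfl | hcd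
  · exact rectIntegral_self_right _ _ _ _ _
  have hzero : ∀ a' b' c' d', a ≤ a' → a' ≤ b' → b' ≤ b → c ≤ c' → c' ≤ d' → d' ≤ d →
      Disjoint (Icc a' b' ×ˢ Icc c' d') S →
      rectIntegral (fun p => L₁ (F p)) (fun p => L₂ (F p)) a' b' c' d' = 0 := by
    intro a' b' c' d' h1 h2 h3 h4 h5 h6 hdisj
    refine rectIntegral_eq_zero_of_locally (O := O) hP hQ (fun q hq => hq) h2 h5 fun q hq => ?_
    by_contra hqO
    exact disjoint_left.1 hdisj hq ⟨Metric.ball_subset_closedBall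
      (hball ⟨Icc_subset_Icc h1 h3 hq.1, Icc_subset_Icc h4 h6 hq.2⟩), hqO⟩
  -- This `ρ` dominates both aspect ratios, which all subrectangles of the same shape share.
  set ρ : ℝ := 1 + (b - a) / (d - c) + (d - c) / (b - a) with hρ
  have hba : 0 < b - a := by linarith
  have hdc : 0 < d - c := by linarith
  have hρ1 : 1 ≤ ρ := by
    have : 0 ≤ (b - a) / (d - c) := by positivity
    have : 0 ≤ (d - c) / (b - a) := by positivity
    linarith
  have hside : b - a ≤ κ ∧ d - c ≤ κ := by
    have q1 := Metric.mem_ball.1 (@hball (a, c) ⟨left_mem_Icc.2 hab.le, left_mem_Icc.2 hcd.le⟩)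
    have q2 := Metric.mem_ball'.1 (@hball (b, d) ⟨right_mem_Icc.2 hab.le, right_mem_Icc.2 hcd.le⟩)
    have q3 : dist ((a, c) : ℝ × ℝ) (b, d) ≤ κ := by linarith [dist_triangle ((a, c) : ℝ × ℝ) p₀ (b, d)]
    rw [dist_comm, Prod.dist_eq, Real.dist_eq, Real.dist_eq] at q3
    exact ⟨(le_abs_self _).trans ((le_max_left _ _).trans q3),
      (le_abs_self _).trans ((le_max_right _ _).trans q3)⟩
  refine rectIntegral_eq_zero_of_le_volume_diff hP hQ hS hab hcd
    (C := (‖L₁‖ + ‖L₂‖) * M * (1 + 4 * ρ)) (by positivity) hzero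
    fun a' b' c' d' h1 h2 h3 h4 h5 h6 hne hshape => ?_
  have aux : ∀ x y u w : ℝ, 0 < u → 0 < w → 0 ≤ y → x * w = y * u → u / w ≤ ρ → x ≤ ρ * y := by
    intro x y u w hu hw hy hxy hle
    have : x = (u / w) * y := by field_simp; linarith
    rw [this]
    exact mul_le_mul_of_nonneg_right hle hy
  refine norm_rectIntegral_le_volume_diff hF hvM hS (fun p hp => (hvF hp).symm) hκ hx hy hSder hρ1
    (fun a'' b'' c'' d'' g1 g2 g3 g4 g5 g6 => hzero a'' b'' c'' d'' (h1.trans g1) g2 (g3.trans h3)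
      (h4.trans g4) g5 (g6.trans h6)) hne (by linarith) (by linarith)
    (aux _ _ _ _ hba hdc (by linarith) hshape ?_) (aux _ _ _ _ hdc hba (by linarith) hshape.symm ?_)
  · have : 0 ≤ (d - c) / (b - a) := by positivity
    linarith
  · have : 0 ≤ (b - a) / (d - c) := by positivity
    linarith

end Baire

/-! ### From rectangles to the standard triangle. -/

section Triangle

open MeasureTheory

variable {V : Type*} [NormedAddCommGroup V] [NormedSpace ℝ V]

theorem rectIntegral_symm {P Q : ℝ × ℝ → V} (hP : Continuous P) (hQ : Continuous Q)
    (a b c d : ℝ) : rectIntegral P Q b a c d = -rectIntegral P Q a b c d := by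
  have h := rectIntegral_add_left hP hQ a b a c d
  rw [rectIntegral_self_left] at h
  exact (neg_eq_of_add_eq_zero_right h).symm

/-- A continuous form whose integrals along the boundaries of rectangles vanish has vanishing
integral along the boundary of the standard triangle. -/
theorem integral_triangle_eq_of_rectIntegral [CompleteSpace V] {P Q : ℝ × ℝ → V}
    (hP : Continuous P) (hQ : Continuous Q)
    (hrect : ∀ a b c d, a ∈ Ioo (-1 : ℝ) 2 → b ∈ Ioo (-1 : ℝ) 2 → c ∈ Ioo (-1 : ℝ) 2 →
      d ∈ Ioo (-1 : ℝ) 2 → a ≤ b → c ≤ d → rectIntegral P Q a b c d = 0) :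
    (∫ s in (0 : ℝ)..1, P (s, 0)) + ∫ t in (0 : ℝ)..1, (Q (1 - t, t) - P (1 - t, t)) =
      ∫ t in (0 : ℝ)..1, Q (0, t) := by
  -- This is the potential along the path that is first horizontal, then vertical. Rectangles make
  -- its increments independent of the path, and integrating its derivative along the hypotenuse
  -- gives the claim.
  set Ψ : ℝ → ℝ → V := fun s t => (∫ x in (0 : ℝ)..s, P (x, 0)) + ∫ y in (0 : ℝ)..t, Q (s, y) with hΨ
  have hPi : ∀ y a b, IntervalIntegrable (fun x => P (x, y)) volume a b := fun y a b =>
    Continuous.intervalIntegrable (by fun_prop) _ _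
  have hQi : ∀ x a b, IntervalIntegrable (fun y => Q (x, y)) volume a b := fun x a b =>
    Continuous.intervalIntegrable (by fun_prop) _ _
  have hdiff : ∀ s s' t t', s ∈ Ioo (-1 : ℝ) 2 → s' ∈ Ioo (-1 : ℝ) 2 → t ∈ Ico (0 : ℝ) 2 →
      Ψ s' t' - Ψ s t = (∫ x in s..s', P (x, t)) + ∫ y in t..t', Q (s', y) := by
    intro s s' t t' hs hs' ht
    have h0 : rectIntegral P Q s s' 0 t = 0 := by
      have ht' : t ∈ Ioo (-1 : ℝ) 2 := ⟨by linarith [ht.1], ht.2⟩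
      rcases le_total s s' with h | h
      · exact hrect _ _ _ _ hs hs' (by norm_num) ht' h ht.1
      · rw [rectIntegral_symm hP hQ, hrect _ _ _ _ hs' hs (by norm_num) ht' h ht.1, neg_zero]
    rw [rectIntegral, intervalIntegral.integral_sub (hPi _ _ _) (hPi _ _ _),
      intervalIntegral.integral_sub (hQi _ _ _) (hQi _ _ _)] at h0
    have e1 := intervalIntegral.integral_add_adjacent_intervals (hPi 0 0 s) (hPi 0 s s')
    have e2 := intervalIntegral.integral_add_adjacent_intervals (hQi s' 0 t) (hQi s' t t')
    simp only [hΨ]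
    rw [← e1, ← e2, ← sub_eq_zero, ← h0]
    abel
  have hder : ∀ t ∈ uIcc (0 : ℝ) 1, HasDerivAt (fun t => Ψ (1 - t) t)
      (Q (1 - t, t) - P (1 - t, t)) t := by
    intro t ht
    rw [uIcc_of_le zero_le_one] at ht
    rw [hasDerivAt_iff_tendsto_slope_zero]
    -- The difference quotient along the hypotenuse is expressed by means over `u ∈ [0, 1]` that are
    -- continuous at `h = 0`.
    have hcont : Continuous fun h : ℝ => (∫ u in (0 : ℝ)..1, Q (1 - (t + h), t + h * u)) -
        ∫ u in (0 : ℝ)..1, P (1 - t + -h * u, t) := by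
      refine Continuous.sub ?_ ?_ <;>
      · refine intervalIntegral.continuous_parametric_intervalIntegral_of_continuous' ?_ _ _
        simp only [Function.uncurry_def]
        fun_prop
    have h0 := hcont.tendsto 0
    simp only [neg_zero, zero_mul, add_zero, intervalIntegral.integral_const, sub_zero,
      one_smul] at h0
    refine (h0.mono_left nhdsWithin_le_nhds).congr' ?_
    have hnear : ∀ᶠ h in 𝓝[≠] (0 : ℝ), h ∈ Ioo (-1 : ℝ) 1 :=
      nhdsWithin_le_nhds (Ioo_mem_nhds (by norm_num) (by norm_num))
    filter_upwards [self_mem_nhdsWithin, hnear] with h hh hI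
    rw [hdiff (1 - t) (1 - (t + h)) t (t + h) ⟨by linarith [ht.2], by linarith [ht.1]⟩
      ⟨by linarith [ht.2, hI.2], by linarith [ht.1, hI.1]⟩ ⟨ht.1, by linarith [ht.2]⟩,
      intervalIntegral.integral_comp_add_mul (fun y => Q (1 - (t + h), y)) hh,
      intervalIntegral.integral_comp_add_mul (fun x => P (x, t)) (neg_ne_zero.2 hh)]
    have e : 1 - t + -h * 1 = 1 - (t + h) := by ring
    simp only [mul_zero, add_zero, mul_one]
    rw [← sub_eq_add_neg, show 1 - t - h = 1 - (t + h) by ring, inv_neg, neg_smul, smul_add]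
    abel
  have hint := intervalIntegral.integral_eq_sub_of_hasDerivAt hder
    (Continuous.intervalIntegrable (by fun_prop) _ _)
  rw [hint]
  simp [hΨ]

end Triangle

/-! ### Segment integrals of monogenic functions as a local cocycle. -/

section SegmentIntegral

open MeasureTheory

variable {E V : Type*} [NormedAddCommGroup E] [NormedSpace ℝ E] [NormedAddCommGroup V]
  [NormedSpace ℝ V]

/-- The integral of `Φ dζ` along the segment from `x` to `y`, where the product of a vector `h` and
a value `u` is `Λ h u`. -/
noncomputable def segmentIntegral (Λ : E →L[ℝ] V →L[ℝ] V) (Φ : E → V) (x y : E) : V :=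
  Λ (y - x) (∫ t in (0 : ℝ)..1, Φ (x + t • (y - x)))

/-- `d` is the Gateaux derivative of `Φ` at `ζ`, taken one-sidedly, with respect to the
product `Λ`. -/
def HasGateauxDeriv (Λ : E →L[ℝ] V →L[ℝ] V) (Φ : E → V) (d : V) (ζ : E) : Prop :=
  ∀ h : E, Tendsto (fun ε : ℝ => ε⁻¹ • (Φ (ζ + ε • h) - Φ ζ)) (𝓝[>] 0) (𝓝 (Λ h d))

variable {Λ : E →L[ℝ] V →L[ℝ] V} {Φ : E → V}

/-- The left-hand limit in direction `h` is minus the right-hand limit in direction `-h`, and `Λ` is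
linear in the direction. -/
theorem HasGateauxDeriv.hasDerivAt {d : V} {ζ : E} (hd : HasGateauxDeriv Λ Φ d ζ) (h : E) :
    HasDerivAt (fun t : ℝ => Φ (ζ + t • h)) (Λ h d) 0 := by
  rw [hasDerivAt_iff_tendsto_slope_zero, ← Iio_union_Ioi, nhdsWithin_union, tendsto_sup]
  simp only [zero_add, zero_smul, add_zero]
  refine ⟨?_, hd h⟩
  have h1 := (hd (-h)).neg
  rw [map_neg, neg_apply, neg_neg] at h1
  have h2 : Tendsto (fun t : ℝ => -t) (𝓝[<] 0) (𝓝[>] 0) := by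
    simpa using tendsto_neg_nhdsLT (a := (0 : ℝ))
  refine (h1.comp h2).congr fun t => ?_
  simp [inv_neg]

/-- In the affine coordinates of the triangle both partial derivatives come from the same `d`, so
the commutation `hΛ` is exactly the closedness condition of the Looman–Menchoff theorem. -/
theorem segmentIntegral_add_of_ball [FiniteDimensional ℝ V]
    (hΛ : ∀ h h' u, Λ h (Λ h' u) = Λ h' (Λ h u)) {ζ : E} {r : ℝ}
    (hΦ : ContinuousOn Φ (Metric.ball ζ (8 * r)))
    (hder : ∀ x ∈ Metric.ball ζ (8 * r), ∃ d, HasGateauxDeriv Λ Φ d x)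
    {x y z : E} (hx : x ∈ Metric.ball ζ r) (hy : y ∈ Metric.ball ζ r)
    (hz : z ∈ Metric.ball ζ r) :
    segmentIntegral Λ Φ x y + segmentIntegral Λ Φ y z = segmentIntegral Λ Φ x z := by
  have : CompleteSpace V := FiniteDimensional.complete ℝ V
  -- Clamping the parameters to `[-1, 2]` makes `F` continuous on the whole plane and changes
  -- nothing near the triangle.
  let cl : ℝ → ℝ := fun s => max (-1) (min 2 s)
  have hcl : Continuous cl := by fun_prop
  have hcl_mem : ∀ s, -1 ≤ cl s ∧ cl s ≤ 2 := fun s =>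
    ⟨le_max_left _ _, max_le (by norm_num) (min_le_left _ _)⟩
  have hcl_eq : ∀ s, -1 ≤ s → s ≤ 2 → cl s = s := fun s h1 h2 => by
    simp only [cl]; rw [min_eq_right h2, max_eq_right h1]
  let σ : ℝ × ℝ → E := fun p => x + p.1 • (y - x) + p.2 • (z - x)
  have hσ : Continuous σ := by fun_prop
  have hσB : ∀ p : ℝ × ℝ, -1 ≤ p.1 → p.1 ≤ 2 → -1 ≤ p.2 → p.2 ≤ 2 →
      σ p ∈ Metric.ball ζ (8 * r) := by
    intro p h1 h2 h3 h4
    rw [Metric.mem_ball, dist_eq_norm] at hx hy hz ⊢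
    have e : σ p - ζ = (1 - p.1 - p.2) • (x - ζ) + p.1 • (y - ζ) + p.2 • (z - ζ) := by
      simp only [σ]; module
    rw [e]
    refine (norm_add₃_le).trans_lt ?_
    rw [norm_smul, norm_smul, norm_smul, Real.norm_eq_abs, Real.norm_eq_abs, Real.norm_eq_abs]
    -- The barycentric coordinates are at most `3`, `2` and `2` in absolute value; their sum `7`
    -- explains the radius `8 * r`.
    have a1 : |1 - p.1 - p.2| ≤ 3 := abs_le.2 ⟨by linarith, by linarith⟩
    have a2 : |p.1| ≤ 2 := abs_le.2 ⟨by linarith, by linarith⟩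
    have a3 : |p.2| ≤ 2 := abs_le.2 ⟨by linarith, by linarith⟩
    have b1 := mul_le_mul a1 hx.le (norm_nonneg _) (by norm_num)
    have b2 := mul_le_mul a2 hy.le (norm_nonneg _) (by norm_num)
    have b3 := mul_le_mul a3 hz.le (norm_nonneg _) (by norm_num)
    have : 0 < r := (norm_nonneg _).trans_lt hx
    linarith
  let F : ℝ × ℝ → V := fun p => Φ (σ (cl p.1, cl p.2))
  have hF : Continuous F := hΦ.comp_continuous (by fun_prop) fun p =>
    hσB _ (hcl_mem _).1 (hcl_mem _).2 (hcl_mem _).1 (hcl_mem _).2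
  have hFeq : ∀ p : ℝ × ℝ, -1 ≤ p.1 → p.1 ≤ 2 → -1 ≤ p.2 → p.2 ≤ 2 → F p = Φ (σ p) := by
    intro p h1 h2 h3 h4
    simp only [F]
    rw [hcl_eq _ h1 h2, hcl_eq _ h3 h4]
  have hUo : IsOpen (Ioo (-1 : ℝ) 2 ×ˢ Ioo (-1 : ℝ) 2) := isOpen_Ioo.prod isOpen_Ioo
  have hFder : ∀ p ∈ Ioo (-1 : ℝ) 2 ×ˢ Ioo (-1 : ℝ) 2, ∃ A B,
      HasDerivAt (fun t : ℝ => F (p + (t, 0))) A 0 ∧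
      HasDerivAt (fun t : ℝ => F (p + (0, t))) B 0 ∧ Λ (z - x) A = Λ (y - x) B := by
    rintro p hp
    obtain ⟨d, hd⟩ := hder (σ p) (hσB p hp.1.1.le hp.1.2.le hp.2.1.le hp.2.2.le)
    refine ⟨_, _, (hd.hasDerivAt (y - x)).congr_of_eventuallyEq ?_,
      (hd.hasDerivAt (z - x)).congr_of_eventuallyEq ?_, hΛ _ _ _⟩
    · have : Tendsto (fun t : ℝ => p + (t, 0)) (𝓝 0) (𝓝 p) := by
        have h : Continuous fun t : ℝ => p + (t, 0) := by fun_prop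
        have h0 : p + ((0 : ℝ), (0 : ℝ)) = p := add_zero p
        simpa [h0] using h.tendsto 0
      filter_upwards [this (hUo.mem_nhds hp)] with t ht
      rw [hFeq _ ht.1.1.le ht.1.2.le ht.2.1.le ht.2.2.le]
      congr 1
      simp only [σ, Prod.fst_add, Prod.snd_add]
      module
    · have : Tendsto (fun t : ℝ => p + (0, t)) (𝓝 0) (𝓝 p) := by
        have h : Continuous fun t : ℝ => p + (0, t) := by fun_prop
        have h0 : p + ((0 : ℝ), (0 : ℝ)) = p := add_zero p
        simpa [h0] using h.tendsto 0
      filter_upwards [this (hUo.mem_nhds hp)] with t ht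
      rw [hFeq _ ht.1.1.le ht.1.2.le ht.2.1.le ht.2.2.le]
      congr 1
      simp only [σ, Prod.fst_add, Prod.snd_add]
      module
  have htri := integral_triangle_eq_of_rectIntegral (P := fun p => Λ (y - x) (F p))
    (Q := fun p => Λ (z - x) (F p)) (by fun_prop) (by fun_prop)
    fun a b c d ha hb hc hd hab hcd => rectIntegral_eq_zero_of_partialDeriv hF hUo hFder hab hcd
      (Set.prod_mono (fun t ht => ⟨ha.1.trans_le ht.1, ht.2.trans_lt hb.2⟩)
        (fun t ht => ⟨hc.1.trans_le ht.1, ht.2.trans_lt hd.2⟩))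
  have hcomm : ∀ (L : V →L[ℝ] V) (g : ℝ → ℝ × ℝ), Continuous g →
      ∫ t in (0 : ℝ)..1, L (F (g t)) = L (∫ t in (0 : ℝ)..1, F (g t)) := fun L g hg =>
    L.intervalIntegral_comp_comm (Continuous.intervalIntegrable (by fun_prop) _ _)
  have hseg : ∀ (u w : E) (g : ℝ → ℝ × ℝ), Continuous g →
      (∀ t ∈ Icc (0 : ℝ) 1, F (g t) = Φ (u + t • (w - u))) →
      ∫ t in (0 : ℝ)..1, Λ (w - u) (F (g t)) = segmentIntegral Λ Φ u w := by
    intro u w g hg h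
    rw [hcomm _ g hg, segmentIntegral]
    congr 1
    refine intervalIntegral.integral_congr fun t ht => h t ?_
    rwa [uIcc_of_le zero_le_one] at ht
  rw [← hseg x y (fun t => (t, 0)) (by fun_prop), ← hseg x z (fun t => (0, t)) (by fun_prop),
    ← hseg y z (fun t => (1 - t, t)) (by fun_prop), ← htri]
  · congr 1
    refine intervalIntegral.integral_congr fun t _ => ?_
    rw [← sub_apply, ← map_sub]
    congr 2
    abel
  · intro t ht
    rw [hFeq _ (by linarith [ht.2]) (by linarith [ht.1]) (by linarith [ht.1]) (by linarith [ht.2])]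
    congr 1
    simp only [σ]
    module
  · intro t ht
    rw [hFeq _ (by norm_num) (by norm_num) (by linarith [ht.1]) (by linarith [ht.2])]
    congr 1
    simp only [σ]
    module
  · intro t ht
    rw [hFeq _ (by linarith [ht.1]) (by linarith [ht.2]) (by norm_num) (by norm_num)]
    congr 1
    simp only [σ]
    module

/-- Near a compact subset of the domain the segment integrals of a function with Gateaux
derivatives form a cocycle. -/
theorem exists_segmentIntegral_add [FiniteDimensional ℝ V]
    (hΛ : ∀ h h' u, Λ h (Λ h' u) = Λ h' (Λ h u)) {Ω C : Set E} (hΩ : IsOpen Ω)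
    (hΦ : ContinuousOn Φ Ω) (hder : ∀ x ∈ Ω, ∃ d, HasGateauxDeriv Λ Φ d x) (hC : IsCompact C)
    (hCΩ : C ⊆ Ω) : ∃ r > 0, ∀ u ∈ C, ∀ x ∈ Metric.ball u r, ∀ y ∈ Metric.ball u r,
      ∀ z ∈ Metric.ball u r,
      segmentIntegral Λ Φ x y + segmentIntegral Λ Φ y z = segmentIntegral Λ Φ x z := by
  have hball : ∀ ζ : C, ∃ r > 0, Metric.ball (ζ : E) (8 * r) ⊆ Ω := fun ζ => by
    obtain ⟨ε, hε, h⟩ := Metric.isOpen_iff.1 hΩ ζ (hCΩ ζ.2)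
    exact ⟨ε / 8, by positivity, by rwa [mul_div_cancel₀ _ (by norm_num)]⟩
  choose r hr0 hr using hball
  obtain ⟨δ, hδ, hleb⟩ := lebesgue_number_lemma_of_metric
    (c := fun ζ : C => Metric.ball (ζ : E) (r ζ)) hC (fun _ => Metric.isOpen_ball)
    (fun q hq => mem_iUnion.2 ⟨⟨q, hq⟩, Metric.mem_ball_self (hr0 _)⟩)
  refine ⟨δ, hδ, fun u hu x hx y hy z hz => ?_⟩
  obtain ⟨ζ, hζ⟩ := hleb u hu
  exact segmentIntegral_add_of_ball hΛ (hΦ.mono (hr ζ)) (fun x hx => hder x (hr ζ hx))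
    (hζ hx) (hζ hy) (hζ hz)

theorem norm_segmentIntegral_sub_le [CompleteSpace V] {x y : E} {u : V} {ε : ℝ}
    (hcont : ContinuousOn (fun t : ℝ => Φ (x + t • (y - x))) (Icc 0 1))
    (hε : ∀ t ∈ Icc (0 : ℝ) 1, ‖Φ (x + t • (y - x)) - u‖ ≤ ε) :
    ‖segmentIntegral Λ Φ x y - Λ (y - x) u‖ ≤ ‖Λ‖ * ‖y - x‖ * ε := by
  have hi : IntervalIntegrable (fun t : ℝ => Φ (x + t • (y - x))) volume 0 1 :=
    ContinuousOn.intervalIntegrable (by rwa [uIcc_of_le zero_le_one])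
  have : segmentIntegral Λ Φ x y - Λ (y - x) u =
      Λ (y - x) (∫ t in (0 : ℝ)..1, (Φ (x + t • (y - x)) - u)) := by
    rw [intervalIntegral.integral_sub hi intervalIntegrable_const, map_sub (Λ (y - x)), segmentIntegral,
      intervalIntegral.integral_const, sub_zero, one_smul]
  rw [this]
  refine (Λ.le_opNorm₂ _ _).trans (mul_le_mul_of_nonneg_left ?_ (by positivity))
  have := intervalIntegral.norm_integral_le_of_norm_le_const (a := (0 : ℝ)) (b := 1)
    (f := fun t : ℝ => Φ (x + t • (y - x)) - u) (C := ε) fun t ht => by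
      rw [uIoc_of_le zero_le_one] at ht
      exact hε t (Ioc_subset_Icc_self ht)
  simpa using this

end SegmentIntegral

/-! ### Primitives of local cocycles. -/

section LocalCocycle

variable {W V : Type*} [NormedAddCommGroup W] [NormedSpace ℝ W] [NormedAddCommGroup V]

/-- A function on an interval that is constant at some fixed small scale is constant. -/
theorem eq_of_forall_dist_lt {V : Type*} {D : ℝ → V} {a b η : ℝ} (hab : a ≤ b) (hη : 0 < η)
    (h : ∀ s ∈ Icc a b, ∀ t ∈ Icc a b, |s - t| < η → D s = D t) : D a = D b := by
  obtain ⟨m, hm⟩ := exists_nat_gt ((b - a) / η)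
  have hm0 : (0 : ℝ) < m := (div_nonneg (by linarith) hη.le).trans_lt hm
  rw [div_lt_iff₀ hη] at hm
  have key : ∀ i : ℕ, i ≤ m → D a = D (a + i / m * (b - a)) := by
    have hmem : ∀ i : ℕ, i ≤ m → a + i / m * (b - a) ∈ Icc a b := by
      intro i hi
      have h1 : (i : ℝ) / m ≤ 1 := (div_le_one hm0).2 (by exact_mod_cast hi)
      have h2 : (0 : ℝ) ≤ (i : ℝ) / m := by positivity
      constructor <;> nlinarith
    intro i
    induction i with
    | zero => intro _; simp
    | succ i ih =>
      intro hi
      rw [ih (by omega)]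
      refine h _ (hmem i (by omega)) _ (hmem _ hi) ?_
      have e : a + (i : ℝ) / m * (b - a) - (a + ((i + 1 : ℕ) : ℝ) / m * (b - a)) =
          -((b - a) / m) := by push_cast; field_simp; ring
      rw [e, abs_neg, abs_of_nonneg (div_nonneg (by linarith) hm0.le), div_lt_iff₀ hm0]
      linarith
  have := key m le_rfl
  rwa [div_self hm0.ne', one_mul, add_sub_cancel] at this

/-- `j` is additive on triples of points of `X` of diameter less than `η`. -/
def IsLocalCocycle {W : Type*} [PseudoMetricSpace W] (j : W → W → V) (X : Set W) (η : ℝ) : Prop :=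
  ∀ x ∈ X, ∀ y ∈ X, ∀ z ∈ X, dist x y < η → dist y z < η → dist x z < η → j x y + j y z = j x z

/-- `G` is a primitive of `j` on `X` at the scale `η`. -/
def IsPrimitiveAt {W : Type*} [PseudoMetricSpace W] (j : W → W → V) (X : Set W) (η : ℝ)
    (G : W → V) : Prop :=
  ∀ x ∈ X, ∀ y ∈ X, dist x y < η → G y - G x = j x y

theorem IsLocalCocycle.mono {W : Type*} [PseudoMetricSpace W] {j : W → W → V} {X Y : Set W} {η : ℝ} (h : IsLocalCocycle j X η)
    (hY : Y ⊆ X) : IsLocalCocycle j Y η := fun x hx y hy z hz =>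
  h x (hY hx) y (hY hy) z (hY hz)

theorem IsPrimitiveAt.mono {W : Type*} [PseudoMetricSpace W] {j : W → W → V} {X Y : Set W} {η : ℝ} {G : W → V}
    (h : IsPrimitiveAt j X η G) (hY : Y ⊆ X) : IsPrimitiveAt j Y η G := fun x hx y hy =>
  h x (hY hx) y (hY hy)

/-- The sum of `j` over the `m` equal parts of the segment from `x` to `y`. -/
noncomputable def chainSum (j : W → W → V) (m : ℕ) (x y : W) : V :=
  ∑ i ∈ Finset.range m,
    j (AffineMap.lineMap x y ((i : ℝ) / m)) (AffineMap.lineMap x y (((i + 1 : ℕ) : ℝ) / m))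

theorem div_mem_Icc_of_le {i m : ℕ} (h : i ≤ m) : (i : ℝ) / m ∈ Icc (0 : ℝ) 1 :=
  ⟨by positivity, div_le_one_of_le₀ (by exact_mod_cast h) (by positivity)⟩

theorem dist_lineMap_div (x y : W) (i : ℕ) {m : ℕ} (hm : 0 < m) :
    dist (AffineMap.lineMap x y ((i : ℝ) / m)) (AffineMap.lineMap x y (((i + 1 : ℕ) : ℝ) / m)) =
      dist x y / m := by
  have hm' : (0 : ℝ) < m := by exact_mod_cast hm
  rw [dist_lineMap_lineMap, Real.dist_eq]
  have : (i : ℝ) / m - ((i + 1 : ℕ) : ℝ) / m = -(1 / m) := by push_cast; field_simp; ring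
  rw [this, abs_neg, abs_of_pos (by positivity)]
  ring

/-- The left side does not involve `G`. Hence the primitives of two triangles with a common side
have the same increment along it. -/
theorem IsPrimitiveAt.chainSum_eq {j : W → W → V} {X : Set W} {η : ℝ} {G : W → V}
    (h : IsPrimitiveAt j X η G) {x y : W} (hX : segment ℝ x y ⊆ X) {m : ℕ}
    (hm : 0 < m) (hd : dist x y / m < η) : chainSum j m x y = G y - G x := by
  have hm' : (m : ℝ) ≠ 0 := by exact_mod_cast hm.ne'
  have hmem : ∀ i ≤ m, AffineMap.lineMap x y ((i : ℝ) / m) ∈ X := fun i hi => hX <| by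
    rw [segment_eq_image_lineMap]
    exact mem_image_of_mem _ (div_mem_Icc_of_le hi)
  have : chainSum j m x y = ∑ i ∈ Finset.range m,
      (G (AffineMap.lineMap x y (((i + 1 : ℕ) : ℝ) / m)) - G (AffineMap.lineMap x y ((i : ℝ) / m))) := by
    refine Finset.sum_congr rfl fun i hi => (h _ (hmem i ?_) _ (hmem (i + 1) ?_) ?_).symm
    · exact (Finset.mem_range.1 hi).le
    · exact Finset.mem_range.1 hi
    · rwa [dist_lineMap_div x y i hm]
  rw [this, Finset.sum_range_sub (fun i : ℕ => G (AffineMap.lineMap x y ((i : ℝ) / m)))]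
  simp [div_self hm']

theorem exists_nat_pos_div_lt (D : ℝ) {η : ℝ} (hη : 0 < η) : ∃ m : ℕ, 0 < m ∧ D / m < η := by
  obtain ⟨m, hm⟩ := exists_nat_gt (max D 0 / η)
  have hm0 : (0 : ℝ) < m := (div_nonneg (le_max_right _ _) hη.le).trans_lt hm
  refine ⟨m, by exact_mod_cast hm0, ?_⟩
  rw [div_lt_iff₀ hη] at hm
  rw [div_lt_iff₀ hm0]
  linarith [le_max_left D 0]

/-- A local cocycle on a bounded convex set has a primitive. -/
theorem IsLocalCocycle.exists_primitive {j : W → W → V} {X : Set W} {η : ℝ}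
    (h : IsLocalCocycle j X η) (hη : 0 < η) (hX : Convex ℝ X) (hb : Bornology.IsBounded X) :
    ∃ G : W → V, IsPrimitiveAt j X (η / 2) G := by
  rcases X.eq_empty_or_nonempty with rfl | ⟨o, ho⟩
  · exact ⟨fun _ => 0, fun x hx => hx.elim⟩
  obtain ⟨C, hC⟩ := Metric.isBounded_iff.1 hb
  obtain ⟨m, hm, hmη⟩ := exists_nat_pos_div_lt C (half_pos hη)
  have hm' : (0 : ℝ) < m := by exact_mod_cast hm
  refine ⟨fun x => chainSum j m o x, fun x hx y hy hxy => ?_⟩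
  set p : W → ℕ → W := fun x i => AffineMap.lineMap o x ((i : ℝ) / m) with hp
  have hpX : ∀ x ∈ X, ∀ i ≤ m, p x i ∈ X := fun x hx i hi =>
    hX.lineMap_mem ho hx (div_mem_Icc_of_le hi)
  have hstep : ∀ x ∈ X, ∀ i, dist (p x i) (p x (i + 1)) < η / 2 := fun x hx i => by
    simp only [hp]
    rw [dist_lineMap_div o x i hm]
    exact (div_le_div_of_nonneg_right (hC ho hx) hm'.le).trans_lt hmη
  have hside : ∀ i ≤ m, dist (p x i) (p y i) < η / 2 := fun i hi => by
    refine lt_of_le_of_lt ?_ hxy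
    have hI := div_mem_Icc_of_le hi
    simp only [hp, AffineMap.lineMap_apply_module, dist_eq_norm]
    have e : (1 - (i : ℝ) / m) • o + ((i : ℝ) / m) • x - ((1 - (i : ℝ) / m) • o + ((i : ℝ) / m) • y) =
      ((i : ℝ) / m) • (x - y) := by module
    rw [e, norm_smul, Real.norm_of_nonneg hI.1]
    exact mul_le_of_le_one_left (norm_nonneg _) hI.2
  -- The two rays from `o` form a ladder. A diagonal, shorter than `η` because the steps and rungs
  -- are below `η / 2`, cuts each cell into two triangles, and the rungs telescope.
  have hladder : ∀ i ∈ Finset.range m, j (p y i) (p y (i + 1)) - j (p x i) (p x (i + 1)) =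
      j (p x (i + 1)) (p y (i + 1)) - j (p x i) (p y i) := by
    intro i hi
    have hi := Finset.mem_range.1 hi
    have hdiag : dist (p x i) (p y (i + 1)) < η :=
      (dist_triangle _ (p x (i + 1)) _).trans_lt (by linarith [hstep x hx i, hside (i + 1) hi])
    have e1 := h _ (hpX x hx i hi.le) _ (hpX x hx _ hi) _ (hpX y hy _ hi)
      (by linarith [hstep x hx i]) (by linarith [hside (i + 1) hi]) hdiag
    have e2 := h _ (hpX x hx i hi.le) _ (hpX y hy _ hi.le) _ (hpX y hy _ hi)
      (by linarith [hside i hi.le]) (by linarith [hstep y hy i]) hdiag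
    rw [sub_eq_sub_iff_add_eq_add, add_comm, e2, add_comm, e1]
  have hoo : j o o = 0 := by
    have := h o ho o ho o ho (by simpa using hη) (by simpa using hη) (by simpa using hη)
    simpa using this
  simp only [chainSum]
  rw [← Finset.sum_sub_distrib, Finset.sum_congr rfl hladder,
    Finset.sum_range_sub (fun i => j (p x i) (p y i))]
  simp only [div_self hm'.ne', hp, hoo, Nat.cast_zero, zero_div, AffineMap.lineMap_apply_zero,
    AffineMap.lineMap_apply_one, sub_zero]

/-- Along a segment that is covered by a loop and misses its base point, the primitives of a
local cocycle on the segment and along the loop have the same increment. -/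
theorem IsPrimitiveAt.increment_eq_of_loop {c : ℝ → W} (hc : Continuous c) {t₀ : ℝ}
    (hinj : InjOn c (Ioo t₀ (t₀ + 1))) (hclosed : c (t₀ + 1) = c t₀) {j : W → W → V} {η : ℝ}
    (hη : 0 < η) {g : ℝ → V}
    (hg : IsPrimitiveAt (fun t t' => j (c t) (c t')) (Icc t₀ (t₀ + 1)) η g) {G : W → V} {x y : W}
    (hG : IsPrimitiveAt j (segment ℝ x y) η G) (hseg : segment ℝ x y ⊆ c '' Icc t₀ (t₀ + 1))
    (hx₀ : c t₀ ∉ segment ℝ x y) {τ τ' : ℝ} (hτ : τ ∈ Icc t₀ (t₀ + 1))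
    (hτ' : τ' ∈ Icc t₀ (t₀ + 1)) (hx : c τ = x) (hy : c τ' = y) :
    G y - G x = g τ' - g τ := by
  have hopen : ∀ t ∈ Icc t₀ (t₀ + 1), c t ∈ segment ℝ x y → t ∈ Ioo t₀ (t₀ + 1) := by
    intro t ht hct
    refine ⟨lt_of_le_of_ne ht.1 ?_, lt_of_le_of_ne ht.2 ?_⟩
    · rintro rfl; exact hx₀ hct
    · rintro rfl; rw [hclosed] at hct; exact hx₀ hct
  have hinj' : ∀ t ∈ Icc t₀ (t₀ + 1), ∀ t' ∈ Icc t₀ (t₀ + 1), c t ∈ segment ℝ x y → c t = c t' →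
      t = t' := fun t ht t' ht' h1 h2 => hinj (hopen t ht h1) (hopen t' ht' (h2 ▸ h1)) h2
  choose! b hbI hbc using fun p (hp : p ∈ segment ℝ x y) => hseg hp
  obtain ⟨δ, hδ, hδb⟩ : ∃ δ > 0, ∀ p ∈ segment ℝ x y, ∀ q ∈ segment ℝ x y, dist p q < δ →
      |b p - b q| < η := by
    have hsegc : IsClosed (segment ℝ x y) := by
      rw [segment_eq_image_lineMap]
      exact (isCompact_Icc.image AffineMap.lineMap_continuous).isClosed
    -- The inverse `b` of the loop is uniformly continuous: on the compact set of parameter pairs at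
    -- distance at least `η`, injectivity keeps the distance of the images away from zero.
    set T : Set (ℝ × ℝ) := (Icc t₀ (t₀ + 1) ×ˢ Icc t₀ (t₀ + 1)) ∩
      {z | c z.1 ∈ segment ℝ x y ∧ η ≤ |z.1 - z.2|} with hT
    have hTc : IsCompact T := by
      refine (isCompact_Icc.prod isCompact_Icc).inter_right (IsClosed.inter ?_ ?_)
      · exact hsegc.preimage (by fun_prop : Continuous fun z : ℝ × ℝ => c z.1)
      · exact isClosed_le continuous_const
          (continuous_fst.sub continuous_snd).abs
    rcases T.eq_empty_or_nonempty with hne | hne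
    · refine ⟨1, one_pos, fun p hp q hq _ => ?_⟩
      by_contra hcon
      have : (b p, b q) ∈ T := ⟨⟨hbI _ hp, hbI _ hq⟩, by simpa [hbc _ hp] using hp, not_lt.1 hcon⟩
      simp [hne] at this
    · obtain ⟨z, hz, hmin⟩ := hTc.exists_isMinOn hne
        (f := fun z : ℝ × ℝ => dist (c z.1) (c z.2)) (by fun_prop)
      refine ⟨dist (c z.1) (c z.2), dist_pos.2 fun heq => ?_, fun p hp q hq hpq => ?_⟩
      · have := hinj' _ hz.1.1 _ hz.1.2 hz.2.1 heq
        have h2 : η ≤ |z.1 - z.2| := hz.2.2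
        rw [this, sub_self, abs_zero] at h2
        linarith
      · by_contra hcon
        have hmem : (b p, b q) ∈ T := ⟨⟨hbI _ hp, hbI _ hq⟩, by simpa [hbc _ hp] using hp, not_lt.1 hcon⟩
        have h3 : dist (c z.1) (c z.2) ≤ dist (c (b p)) (c (b q)) := hmin hmem
        rw [hbc _ hp, hbc _ hq] at h3
        linarith
  have hl : ∀ s ∈ Icc (0 : ℝ) 1, AffineMap.lineMap x y s ∈ segment ℝ x y := fun s hs => by
    rw [segment_eq_image_lineMap]; exact mem_image_of_mem _ hs
  -- Close points of the segment have close parameters, so `G` and `g ∘ b` have the same small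
  -- increments. The summand `1` in the denominator covers a degenerate segment.
  have key := eq_of_forall_dist_lt (D := fun s : ℝ => G (AffineMap.lineMap x y s) -
    g (b (AffineMap.lineMap x y s))) (η := min η δ / (dist x y + 1)) zero_le_one
    (div_pos (lt_min hη hδ) (by positivity)) (by
      intro s hs s' hs' hss
      rw [lt_div_iff₀ (by positivity)] at hss
      have hd : dist (AffineMap.lineMap x y s : W) (AffineMap.lineMap x y s') < min η δ := by
        rw [dist_lineMap_lineMap, Real.dist_eq]
        nlinarith [abs_nonneg (s - s')]
      have e1 := hG _ (hl s hs) _ (hl s' hs') (hd.trans_le (min_le_left _ _))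
      have e2 := hg _ (hbI _ (hl s hs)) _ (hbI _ (hl s' hs'))
        (hδb _ (hl s hs) _ (hl s' hs') (hd.trans_le (min_le_right _ _)))
      simp only [hbc _ (hl s hs), hbc _ (hl s' hs')] at e2
      rw [← e2] at e1
      rw [sub_eq_sub_iff_sub_eq_sub, ← neg_sub, e1, neg_sub])
  have hxs : x ∈ segment ℝ x y := left_mem_segment ℝ x y
  have hys : y ∈ segment ℝ x y := right_mem_segment ℝ x y
  have hbx : b x = τ := hinj' _ (hbI _ hxs) _ hτ (by rwa [hbc _ hxs]) ((hbc _ hxs).trans hx.symm)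
  have hby : b y = τ' := hinj' _ (hbI _ hys) _ hτ' (by rwa [hbc _ hys]) ((hbc _ hys).trans hy.symm)
  simp only [AffineMap.lineMap_apply_zero, AffineMap.lineMap_apply_one, hbx, hby] at key
  rw [← neg_sub, sub_eq_sub_iff_sub_eq_sub.1 key, neg_sub]

end LocalCocycle

/-! ### Cancellation of inner sides. -/

section BoundarySum

variable {N : ℕ} (K : TriangulatedSurface N) {V : Type*} [AddCommGroup V]

/-- The three directed sides of a triangle. -/
def triangleSides {α : Type*} [DecidableEq α] (s : α × α × α) : Finset (α × α) :=
  {(s.1, s.2.1), (s.2.1, s.2.2), (s.2.2, s.1)}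

theorem mem_triangleSides {α : Type*} [DecidableEq α] {s : α × α × α} {u v : α} :
    (u, v) ∈ triangleSides s ↔ IsSideOf u v s := by
  obtain ⟨a, b, c⟩ := s
  simp [triangleSides, IsSideOf]

open scoped Classical in
/-- The directed boundary edges. -/
noncomputable def TriangulatedSurface.boundaryEdges : Finset (Fin N × Fin N) :=
  Finset.univ.filter fun p => K.IsBoundaryEdge p.1 p.2

theorem TriangulatedSurface.mem_boundaryEdges {p : Fin N × Fin N} :
    p ∈ K.boundaryEdges ↔ K.IsBoundaryEdge p.1 p.2 := by
  simp [boundaryEdges]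

variable {K}

theorem IsSideOf.ne {s : Fin N × Fin N × Fin N} (hs : s ∈ K.tri) {u v : Fin N}
    (h : IsSideOf u v s) : u ≠ v := by
  obtain ⟨h1, h2, h3⟩ := K.nondegenerate s hs
  rcases h with ⟨rfl, rfl⟩ | ⟨rfl, rfl⟩ | ⟨rfl, rfl⟩
  exacts [h1, h2, h3.symm]

/-- Sides that are not boundary edges cancel in the sum over all triangles. -/
theorem TriangulatedSurface.sum_boundaryEdges {I : Fin N → Fin N → V}
    (hI : ∀ s ∈ K.tri, ∀ u v, IsSideOf u v s → I v u = -I u v) :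
    ∑ p ∈ K.boundaryEdges, I p.1 p.2 =
      ∑ s ∈ K.tri, (I s.1 s.2.1 + I s.2.1 s.2.2 + I s.2.2 s.1) := by
  classical
  have h1 : ∀ s ∈ K.tri, I s.1 s.2.1 + I s.2.1 s.2.2 + I s.2.2 s.1 =
      ∑ p ∈ triangleSides s, I p.1 p.2 := by
    rintro ⟨a, b, c⟩ hs
    obtain ⟨h1, h2, h3⟩ := K.nondegenerate _ hs
    rw [triangleSides, Finset.sum_insert, Finset.sum_insert, Finset.sum_singleton, add_assoc]
    · simpa using fun _ => h3.symm
    · simpa using ⟨fun h => (h1 h).elim, fun h => (h3 h).elim⟩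
  rw [Finset.sum_congr rfl h1, ← Finset.sum_biUnion]
  · have hsub : K.boundaryEdges ⊆ K.tri.biUnion triangleSides := by
      intro p hp
      obtain ⟨⟨s, hs, hside⟩, -⟩ := K.mem_boundaryEdges.1 hp
      exact Finset.mem_biUnion.2 ⟨s, hs, mem_triangleSides.2 hside⟩
    rw [← Finset.sum_sdiff hsub, right_eq_add]
    have hmem : ∀ p : Fin N × Fin N, p ∈ K.tri.biUnion triangleSides \ K.boundaryEdges ↔
        (∃ s ∈ K.tri, IsSideOf p.1 p.2 s) ∧ ∃ s ∈ K.tri, IsSideOf p.2 p.1 s := by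
      rintro ⟨u, v⟩
      rw [Finset.mem_sdiff, K.mem_boundaryEdges, Finset.mem_biUnion]
      simp only [mem_triangleSides, IsBoundaryEdge]
      constructor
      · rintro ⟨h1, h2⟩
        refine ⟨h1, ?_⟩
        by_contra! hcon
        exact h2 ⟨h1, hcon⟩
      · rintro ⟨h1, s, hs, h2⟩
        exact ⟨h1, fun h => h.2 s hs h2⟩
    refine Finset.sum_involution (fun p _ => p.swap) (fun p hp => ?_) (fun p hp _ => ?_)
      (fun p hp => ?_) (fun p hp => p.swap_swap)
    · obtain ⟨⟨s, hs, hside⟩, -⟩ := (hmem p).1 hp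
      simp [hI s hs _ _ hside]
    · obtain ⟨⟨s, hs, hside⟩, -⟩ := (hmem p).1 hp
      intro heq
      exact IsSideOf.ne hs hside (congrArg Prod.snd heq)
    · exact (hmem _).2 ((hmem p).1 hp).symm
  · intro s hs t ht hst
    refine Finset.disjoint_left.2 fun p hp hp' => hst ?_
    exact K.oriented s hs t ht p.1 p.2 (mem_triangleSides.1 hp) (mem_triangleSides.1 hp')

end BoundarySum

/-! ### Geometry of the realization and its boundary. -/

section Realization

namespace TriangulatedSurface

variable {N : ℕ} {K : TriangulatedSurface N}

theorem isCompact_carrier (K : TriangulatedSurface N) : IsCompact K.carrier :=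
  K.tri.isCompact_biUnion fun _ _ => (Set.toFinite _).isCompact_convexHull ℝ

theorem isVertexOf_of_isSideOf {u v : Fin N} {s : Fin N × Fin N × Fin N} (h : IsSideOf u v s) :
    vertex u ∈ convexHull ℝ {vertex s.1, vertex s.2.1, vertex s.2.2} ∧
      vertex v ∈ convexHull ℝ {vertex s.1, vertex s.2.1, vertex s.2.2} := by
  constructor <;> refine subset_convexHull ℝ _ ?_ <;>
    rcases h with ⟨rfl, rfl⟩ | ⟨rfl, rfl⟩ | ⟨rfl, rfl⟩ <;> simp

theorem segment_subset_of_isSideOf {u v : Fin N} {s : Fin N × Fin N × Fin N}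
    (h : IsSideOf u v s) : segment ℝ (vertex u) (vertex v) ⊆
      convexHull ℝ {vertex s.1, vertex s.2.1, vertex s.2.2} :=
  (convex_convexHull ℝ _).segment_subset (isVertexOf_of_isSideOf h).1 (isVertexOf_of_isSideOf h).2

theorem hull_subset_carrier {s : Fin N × Fin N × Fin N} (hs : s ∈ K.tri) :
    convexHull ℝ {vertex s.1, vertex s.2.1, vertex s.2.2} ⊆ K.carrier :=
  Set.subset_biUnion_of_mem (u := fun s : Fin N × Fin N × Fin N =>
    convexHull ℝ {vertex s.1, vertex s.2.1, vertex s.2.2}) hs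

theorem boundary_eq_biUnion (K : TriangulatedSurface N) :
    K.boundary = ⋃ p ∈ K.boundaryEdges, segment ℝ (vertex p.1) (vertex p.2) := by
  ext x
  simp only [boundary, Set.mem_ofPred_eq, mem_iUnion, mem_boundaryEdges, exists_prop, Prod.exists]

theorem segment_subset_boundary {u v : Fin N} (h : K.IsBoundaryEdge u v) :
    segment ℝ (vertex u) (vertex v) ⊆ K.boundary := fun _ hx => ⟨u, v, h, hx⟩

theorem boundary_subset_carrier (K : TriangulatedSurface N) : K.boundary ⊆ K.carrier := by
  rintro x ⟨u, v, ⟨⟨s, hs, hside⟩, -⟩, hx⟩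
  exact hull_subset_carrier hs (segment_subset_of_isSideOf hside hx)

theorem isClosed_segment {W : Type*} [NormedAddCommGroup W] [NormedSpace ℝ W] (x y : W) :
    IsClosed (segment ℝ x y) := by
  rw [segment_eq_image_lineMap]
  exact (isCompact_Icc.image AffineMap.lineMap_continuous).isClosed

theorem isCompact_boundary (K : TriangulatedSurface N) : IsCompact K.boundary := by
  refine K.isCompact_carrier.of_isClosed_subset ?_ K.boundary_subset_carrier
  rw [boundary_eq_biUnion]
  exact K.boundaryEdges.finite_toSet.isClosed_biUnion fun p _ => isClosed_segment _ _

theorem lineMap_vertex_apply_snd {u v : Fin N} (h : u ≠ v) (s : ℝ) :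
    (AffineMap.lineMap (vertex u) (vertex v) s : Fin N → ℝ) v = s := by
  simp [AffineMap.lineMap_apply_module, vertex, h.symm]

theorem lineMap_vertex_apply_fst {u v : Fin N} (h : u ≠ v) (s : ℝ) :
    (AffineMap.lineMap (vertex u) (vertex v) s : Fin N → ℝ) u = 1 - s := by
  simp [AffineMap.lineMap_apply_module, vertex, h]

theorem eq_or_eq_of_mem_segment {u v w : Fin N} {x : Fin N → ℝ}
    (hx : x ∈ segment ℝ (vertex u) (vertex v)) (hw : x w ≠ 0) : w = u ∨ w = v := by
  by_contra! hcon
  rw [segment_eq_image_lineMap] at hx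
  obtain ⟨s, -, rfl⟩ := hx
  exact hw (by simp [AffineMap.lineMap_apply_module, vertex, hcon.1, hcon.2])

/-- An interior point of a boundary edge lies on no other boundary edge. -/
theorem IsBoundaryEdge.notMem_segment {u v : Fin N} (h : K.IsBoundaryEdge u v) {p : Fin N × Fin N}
    (hp : K.IsBoundaryEdge p.1 p.2) (hne : p ≠ (u, v)) {s : ℝ} (hs0 : s ≠ 0) (hs1 : s ≠ 1) :
    AffineMap.lineMap (vertex u) (vertex v) s ∉ segment ℝ (vertex p.1) (vertex p.2) := by
  obtain ⟨⟨r, hr, hside⟩, h2⟩ := h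
  have huv := IsSideOf.ne hr hside
  intro hmem
  have e1 := eq_or_eq_of_mem_segment hmem (w := v) (by rwa [lineMap_vertex_apply_snd huv])
  have e2 := eq_or_eq_of_mem_segment hmem (w := u)
    (by rw [lineMap_vertex_apply_fst huv]; exact sub_ne_zero.2 hs1.symm)
  obtain ⟨p1, p2⟩ := p
  obtain ⟨⟨r', hr', hside'⟩, -⟩ := hp
  simp only at *
  -- Both coordinates of an interior point are nonzero, so the other edge has the same endpoints.
  -- The reversed edge is excluded by the definition of a boundary edge.
  rcases e1 with rfl | rfl <;> rcases e2 with rfl | rfl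
  · exact huv rfl
  · exact h2 r' hr' hside'
  · exact hne rfl
  · exact huv rfl

end TriangulatedSurface

end Realization

/-! ### The period along the boundary loop vanishes. -/

section Loop

variable {V : Type*} [NormedAddCommGroup V]

theorem IsPrimitiveAt.mono_scale {W : Type*} [PseudoMetricSpace W] {j : W → W → V} {X : Set W}
    {η θ : ℝ} {G : W → V} (h : IsPrimitiveAt j X η G) (hθ : θ ≤ η) : IsPrimitiveAt j X θ G :=
  fun x hx y hy hxy => h x hx y hy (hxy.trans_le hθ)

theorem eq_of_sub_eq_intCast {t t' : ℝ} (h : ∃ n : ℤ, t - t' = n) (hlt : |t - t'| < 1) :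
    t = t' := by
  obtain ⟨n, hn⟩ := h
  rw [hn] at hlt
  have : |n| < 1 := by exact_mod_cast hlt
  rw [Int.abs_lt_one_iff.1 this] at hn
  simpa [sub_eq_zero] using hn

open TriangulatedSurface in
/-- A local cocycle on a triangulated surface has no period along a simple loop that runs through
the whole boundary. -/
theorem TriangulatedSurface.increment_boundary_loop_eq_zero {N : ℕ} {K : TriangulatedSurface N}
    {j : (Fin N → ℝ) → (Fin N → ℝ) → V} {η : ℝ} (hη : 0 < η) (hj : IsLocalCocycle j K.carrier η)
    {c : ℝ → Fin N → ℝ} (hc : Continuous c) (hper : Function.Periodic c 1)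
    (hinj : ∀ t t', c t = c t' → ∃ n : ℤ, t - t' = n) (hrange : range c = K.boundary)
    {g : ℝ → V} {θ : ℝ} (hθ : 0 < θ)
    (hg : IsPrimitiveAt (fun t t' => j (c t) (c t')) (Icc (-1) 3) θ g) : g 1 = g 0 := by
  obtain ⟨μ, hμ, hμη, hμθ⟩ : ∃ μ > 0, μ ≤ η / 2 ∧ μ ≤ θ :=
    ⟨min (η / 2) θ, lt_min (half_pos hη) hθ, min_le_left _ _, min_le_right _ _⟩
  have hgμ := hg.mono_scale hμθ
  obtain ⟨u₀, v₀, he₀, -⟩ : c 0 ∈ K.boundary := hrange ▸ mem_range_self 0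
  have huv : u₀ ≠ v₀ := by
    obtain ⟨⟨s, hs, hside⟩, -⟩ := he₀
    exact IsSideOf.ne hs hside
  have hx₀seg : AffineMap.lineMap (vertex u₀) (vertex v₀) (1 / 2 : ℝ) ∈
      segment ℝ (vertex u₀) (vertex v₀) := by
    rw [segment_eq_image_lineMap]
    exact mem_image_of_mem _ ⟨by norm_num, by norm_num⟩
  -- The loop is cut at the midpoint of a boundary edge, which lies on no other boundary edge; a
  -- vertex would not do.
  obtain ⟨t₀, ht₀, hct₀⟩ : ∃ t ∈ Ico (0 : ℝ) 1, c t =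
      AffineMap.lineMap (vertex u₀) (vertex v₀) (1 / 2 : ℝ) := by
    obtain ⟨t, ht⟩ : AffineMap.lineMap (vertex u₀) (vertex v₀) (1 / 2 : ℝ) ∈ range c :=
      hrange ▸ segment_subset_boundary he₀ hx₀seg
    obtain ⟨t', ht', h⟩ := hper.exists_mem_Ico₀ one_pos t
    exact ⟨t', ht', h.symm.trans ht⟩
  have hper1 : ∀ t, c (t + 1) = c t := hper
  -- The increment of `g` over one period does not depend on where it starts.
  have hT : ∀ t ∈ Icc (-1 : ℝ) 2, g (t + 1) - g t = g 1 - g 0 := by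
    have key : ∀ t ∈ Icc (-1 : ℝ) 2, g (-1 + 1) - g (-1) = g (t + 1) - g t := fun t ht =>
      eq_of_forall_dist_lt (D := fun t => g (t + 1) - g t) ht.1 hθ fun s hs s' hs' hss => by
        have hs2 : s ≤ 2 := hs.2.trans ht.2
        have hs2' : s' ≤ 2 := hs'.2.trans ht.2
        have e1 := hg s ⟨hs.1, by linarith⟩ s' ⟨hs'.1, by linarith⟩ hss
        have e2 := hg (s + 1) ⟨by linarith [hs.1], by linarith⟩ (s' + 1)
          ⟨by linarith [hs'.1], by linarith⟩ (by rwa [dist_add_right])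
        simp only [hper1] at e2
        rw [eq_comm]
        exact sub_eq_sub_iff_sub_eq_sub.1 (e2.trans e1.symm)
    intro t ht
    rw [← key t ht, key 0 ⟨by norm_num, by norm_num⟩, zero_add]
  have hinjIoo : InjOn c (Ioo t₀ (t₀ + 1)) := fun t ht t' ht' h =>
    eq_of_sub_eq_intCast (hinj t t' h)
      (abs_lt.2 ⟨by linarith [ht.1, ht'.2], by linarith [ht.2, ht'.1]⟩)
  have hsurj : K.boundary ⊆ c '' Icc t₀ (t₀ + 1) := by
    intro x hx
    obtain ⟨t, rfl⟩ : x ∈ range c := hrange ▸ hx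
    obtain ⟨t', ht', h⟩ := hper.exists_mem_Ico one_pos t t₀
    exact ⟨t', Ico_subset_Icc_self ht', h.symm⟩
  have hvert : ∀ u : Fin N, ∃ t, vertex u ∈ K.boundary → t ∈ Icc t₀ (t₀ + 1) ∧ c t = vertex u := by
    intro u
    by_cases hu : vertex u ∈ K.boundary
    · obtain ⟨t, ht, h⟩ := hsurj hu
      exact ⟨t, fun _ => ⟨ht, h⟩⟩
    · exact ⟨0, fun h => (hu h).elim⟩
  choose r hr using hvert
  have hgI : IsPrimitiveAt (fun t t' => j (c t) (c t')) (Icc t₀ (t₀ + 1)) μ g :=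
    hgμ.mono (Icc_subset_Icc (by linarith [ht₀.1]) (by linarith [ht₀.2]))
  have hG : ∀ s ∈ K.tri, ∃ G, IsPrimitiveAt j
      (convexHull ℝ {vertex s.1, vertex s.2.1, vertex s.2.2}) μ G := fun s hs => by
    obtain ⟨G, hG⟩ := (hj.mono (hull_subset_carrier hs)).exists_primitive hη (convex_convexHull ℝ _)
      ((Set.toFinite _).isCompact_convexHull ℝ).isBounded
    exact ⟨G, hG.mono_scale hμη⟩
  choose! G hG using hG
  obtain ⟨C, hC⟩ := Metric.isBounded_iff.1 (Set.finite_range (vertex (N := N))).isBounded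
  obtain ⟨m, hm, hmμ⟩ := exists_nat_pos_div_lt C hμ
  have hdist : ∀ u v : Fin N, dist (vertex u) (vertex v) / m < μ := fun u v =>
    (div_le_div_of_nonneg_right (hC (mem_range_self u) (mem_range_self v))
      (by positivity)).trans_lt hmμ
  set I : Fin N → Fin N → V := fun u v => chainSum j m (vertex u) (vertex v) with hIdef
  have hIG : ∀ s ∈ K.tri, ∀ u v, IsSideOf u v s →
      I u v = G s (vertex v) - G s (vertex u) ∧ I v u = G s (vertex u) - G s (vertex v) := by
    intro s hs u v huv
    have hsub := segment_subset_of_isSideOf huv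
    exact ⟨(hG s hs).chainSum_eq hsub hm (hdist u v),
      (hG s hs).chainSum_eq (segment_symm ℝ (vertex u) (vertex v) ▸ hsub) hm (hdist v u)⟩
  have hsumI : ∑ p ∈ K.boundaryEdges, I p.1 p.2 = 0 := by
    rw [sum_boundaryEdges fun s hs u v h => ?_]
    · refine Finset.sum_eq_zero fun s hs => ?_
      rw [(hIG s hs s.1 s.2.1 (Or.inl ⟨rfl, rfl⟩)).1,
        (hIG s hs s.2.1 s.2.2 (Or.inr (Or.inl ⟨rfl, rfl⟩))).1,
        (hIG s hs s.2.2 s.1 (Or.inr (Or.inr ⟨rfl, rfl⟩))).1]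
      abel
    · rw [(hIG s hs u v h).1, (hIG s hs u v h).2, neg_sub]
  -- Increments of a function of the vertices cancel in every triangle, whatever the values at
  -- vertices off the boundary, where `r` is arbitrary.
  have hsumr : ∑ p ∈ K.boundaryEdges, (g (r p.2) - g (r p.1)) = 0 := by
    rw [sum_boundaryEdges (I := fun u v => g (r v) - g (r u)) fun s hs u v h => (neg_sub _ _).symm]
    refine Finset.sum_eq_zero fun s hs => ?_
    abel
  have hedge : ∀ p ∈ K.boundaryEdges, p ≠ (u₀, v₀) →
      I p.1 p.2 - (g (r p.2) - g (r p.1)) = 0 := by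
    intro p hp hne
    have hpe := K.mem_boundaryEdges.1 hp
    obtain ⟨⟨s, hs, hside⟩, -⟩ := id hpe
    have hsub := segment_subset_boundary hpe
    have h1 := hr p.1 (hsub (left_mem_segment ℝ _ _))
    have h2 := hr p.2 (hsub (right_mem_segment ℝ _ _))
    rw [(hIG s hs _ _ hside).1, sub_eq_zero]
    refine IsPrimitiveAt.increment_eq_of_loop hc hinjIoo (hper1 t₀) hμ hgI
      ((hG s hs).mono (segment_subset_of_isSideOf hside)) (hsub.trans hsurj) ?_ h1.1 h2.1 h1.2 h2.2
    rw [hct₀]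
    exact he₀.notMem_segment hpe hne (by norm_num) (by norm_num)
  -- Both sums vanish and agree term by term on all other edges, so they agree on the cut edge as
  -- well.
  have hI₀ : I u₀ v₀ - (g (r v₀) - g (r u₀)) = 0 := by
    have h := Finset.sum_eq_single_of_mem (u₀, v₀) (K.mem_boundaryEdges.2 he₀) hedge
    rw [Finset.sum_sub_distrib, hsumI, hsumr, sub_zero] at h
    exact h.symm
  obtain ⟨ε, hε, hε1, hεμ, hεseg, hεdist⟩ : ∃ ε > 0, ε < 1 / 4 ∧ 2 * ε < μ ∧
      (∀ t, |t - t₀| ≤ ε → c t ∈ segment ℝ (vertex u₀) (vertex v₀)) ∧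
      ∀ t, |t - t₀| ≤ ε → dist (c t) (c t₀) < μ / 2 := by
    have hcl : IsClosed (⋃ p ∈ K.boundaryEdges.erase (u₀, v₀),
        segment ℝ (vertex p.1) (vertex p.2)) :=
      (Finset.finite_toSet _).isClosed_biUnion fun p _ => isClosed_segment _ _
    have h1 : ∀ᶠ t in 𝓝 t₀, c t ∉ ⋃ p ∈ K.boundaryEdges.erase (u₀, v₀),
        segment ℝ (vertex p.1) (vertex p.2) := by
      refine hc.continuousAt.eventually_mem (hcl.isOpen_compl.mem_nhds ?_)
      rw [mem_compl_iff, mem_iUnion₂]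
      rintro ⟨p, hp, hmem⟩
      rw [Finset.mem_erase] at hp
      rw [hct₀] at hmem
      exact he₀.notMem_segment (K.mem_boundaryEdges.1 hp.2) hp.1 (by norm_num) (by norm_num) hmem
    have h2 : ∀ᶠ t in 𝓝 t₀, dist (c t) (c t₀) < μ / 2 :=
      hc.continuousAt.eventually_mem (Metric.ball_mem_nhds _ (half_pos hμ))
    obtain ⟨ε, hε, hball⟩ := Metric.eventually_nhds_iff.1 (h1.and h2)
    refine ⟨min (ε / 2) (min (1 / 8) (μ / 4)), by positivity,
      ((min_le_right _ _).trans (min_le_left _ _)).trans_lt (by norm_num),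
      by linarith [(min_le_right (ε / 2) (min (1 / 8) (μ / 4))).trans (min_le_right _ _)], fun t ht => ?_, fun t ht => ?_⟩
    all_goals
      have hlt : dist t t₀ < ε := by
        rw [Real.dist_eq]
        exact (ht.trans (min_le_left _ _)).trans_lt (half_lt_self hε)
    · obtain ⟨u, v, he, hmem⟩ : c t ∈ K.boundary := hrange ▸ mem_range_self t
      by_cases h : (u, v) = (u₀, v₀)
      · cases h; exact hmem
      · refine ((hball hlt).1 (mem_iUnion₂.2 ⟨(u, v), ?_, hmem⟩)).elim
        exact Finset.mem_erase.2 ⟨h, K.mem_boundaryEdges.2 he⟩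
    · exact (hball hlt).2
  have hlm : ∀ x ∈ segment ℝ (vertex u₀) (vertex v₀),
      x = AffineMap.lineMap (vertex u₀) (vertex v₀) (x v₀) := by
    intro x hx
    rw [segment_eq_image_lineMap] at hx
    obtain ⟨s, -, rfl⟩ := hx
    rw [lineMap_vertex_apply_snd huv]
  have hπt₀ : c t₀ v₀ = 1 / 2 := by rw [hct₀, lineMap_vertex_apply_snd huv]
  -- The coordinate at `v₀` parametrizes the cut edge. Being injective and continuous along the loop
  -- near `t₀`, it is strictly monotone there, which gives two directions of passage.
  have hπinj : InjOn (fun t => c t v₀) (Icc (t₀ - ε) (t₀ + ε)) := by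
    intro t ht t' ht' h
    have h1 := hεseg t (abs_le.2 ⟨by linarith [ht.1], by linarith [ht.2]⟩)
    have h2 := hεseg t' (abs_le.2 ⟨by linarith [ht'.1], by linarith [ht'.2]⟩)
    simp only at h
    refine eq_of_sub_eq_intCast (hinj t t' ?_)
      (abs_lt.2 ⟨by linarith [ht.1, ht'.2], by linarith [ht.2, ht'.1]⟩)
    rw [hlm _ h1, hlm _ h2, h]
  have hπc : ContinuousOn (fun t => c t v₀) (Icc (t₀ - ε) (t₀ + ε)) := by fun_prop
  obtain ⟨⟨s, hs, hside⟩, -⟩ := id he₀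
  have hGseg := (hG s hs).mono (segment_subset_of_isSideOf hside)
  have hsub := segment_subset_boundary he₀
  have hru := hr u₀ (hsub (left_mem_segment ℝ _ _))
  have hrv := hr v₀ (hsub (right_mem_segment ℝ _ _))
  have hle : ∀ τ ∈ Icc t₀ (t₀ + 1), c τ ∈ segment ℝ (vertex u₀) (vertex v₀) → c τ v₀ < 1 / 2 →
      G s (c τ) - G s (vertex u₀) = g τ - g (r u₀) := by
    intro τ hτ hmem hlt
    have hss := (convex_segment (𝕜 := ℝ) (vertex u₀) (vertex v₀)).segment_subset
      (left_mem_segment ℝ _ _) hmem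
    refine IsPrimitiveAt.increment_eq_of_loop hc hinjIoo (hper1 t₀) hμ hgI (hGseg.mono hss)
      ((hss.trans hsub).trans hsurj) (fun hcon => ?_) hru.1 hτ hru.2 rfl
    have hconv : Convex ℝ {x : Fin N → ℝ | x v₀ < 1 / 2} :=
      convex_halfSpace_lt (LinearMap.proj (R := ℝ) (φ := fun _ : Fin N => ℝ) v₀).isLinear _
    have := hconv.segment_subset (x := vertex u₀) (y := c τ) (by simp [vertex, huv.symm]) hlt hcon
    exact this.ne hπt₀
  have hge : ∀ τ ∈ Icc t₀ (t₀ + 1), c τ ∈ segment ℝ (vertex u₀) (vertex v₀) → 1 / 2 < c τ v₀ →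
      G s (vertex v₀) - G s (c τ) = g (r v₀) - g τ := by
    intro τ hτ hmem hlt
    have hss := (convex_segment (𝕜 := ℝ) (vertex u₀) (vertex v₀)).segment_subset
      hmem (right_mem_segment ℝ _ _)
    refine IsPrimitiveAt.increment_eq_of_loop hc hinjIoo (hper1 t₀) hμ hgI (hGseg.mono hss)
      ((hss.trans hsub).trans hsurj) (fun hcon => ?_) hτ hrv.1 rfl hrv.2
    have hconv : Convex ℝ {x : Fin N → ℝ | 1 / 2 < x v₀} :=
      convex_halfSpace_gt (LinearMap.proj (R := ℝ) (φ := fun _ : Fin N => ℝ) v₀).isLinear _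
    have := hconv.segment_subset (x := c τ) (y := vertex v₀) hlt (by simp [vertex]; norm_num) hcon
    exact this.ne' hπt₀
  -- On the cut interval the point `c t₂` has parameter `t₂ + 1`, while across the cut its parameter
  -- is `t₂`. This discrepancy brings in the period.
  set t₁ := t₀ + ε with ht₁
  set t₂ := t₀ - ε with ht₂
  have a1 : |t₁ - t₀| ≤ ε := by rw [ht₁, add_sub_cancel_left, abs_of_pos hε]
  have a2 : |t₂ - t₀| ≤ ε := by rw [ht₂, sub_sub_cancel_left, abs_neg, abs_of_pos hε]
  have hI1 : t₁ ∈ Icc t₀ (t₀ + 1) := ⟨by linarith, by linarith⟩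
  have hI2 : t₂ + 1 ∈ Icc t₀ (t₀ + 1) := ⟨by linarith, by linarith⟩
  have s1 := hεseg t₁ a1
  have s2 := hεseg t₂ a2
  have hd21 : dist (c t₂) (c t₁) < μ := by
    have := dist_triangle_right (c t₂) (c t₁) (c t₀)
    linarith [hεdist t₁ a1, hεdist t₂ a2]
  have hT2 := hT t₂ ⟨by linarith [ht₀.1], by linarith [ht₀.2]⟩
  have hmid : G s (c t₁) - G s (c t₂) = g t₁ - g t₂ := by
    rw [hGseg _ s2 _ s1 hd21]
    refine (hgμ t₂ ⟨by linarith [ht₀.1], by linarith [ht₀.2]⟩ t₁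
      ⟨by linarith [ht₀.1], by linarith [ht₀.2]⟩ ?_).symm
    rw [Real.dist_eq, abs_of_nonpos (by linarith)]
    linarith
  rw [(hIG s hs _ _ hside).1] at hI₀
  rcases hπc.strictMonoOn_of_injOn_Icc' (by linarith) hπinj with hmono | hanti
  · have l2 : c t₂ v₀ < 1 / 2 := hπt₀ ▸ hmono ⟨le_rfl, by linarith⟩ ⟨by linarith, by linarith⟩
      (by linarith)
    have l1 : 1 / 2 < c t₁ v₀ := hπt₀ ▸ hmono ⟨by linarith, by linarith⟩ ⟨by linarith, le_rfl⟩
      (by linarith)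
    have e1 := hle (t₂ + 1) hI2 (by rwa [hper1]) (by rwa [hper1])
    have e2 := hge t₁ hI1 s1 l1
    rw [hper1] at e1
    -- The outer pieces avoid the cut, and the middle one crosses it. After substitution `hI₀` reads
    -- `g (t₂ + 1) - g t₂ = 0`; in the opposite direction the same holds with a minus sign.
    have : G s (vertex v₀) - G s (vertex u₀) = (G s (vertex v₀) - G s (c t₁)) +
      (G s (c t₁) - G s (c t₂)) + (G s (c t₂) - G s (vertex u₀)) := by abel
    rw [this, e1, e2, hmid] at hI₀
    rw [← sub_eq_zero, ← hT2, ← hI₀]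
    abel
  · have l2 : 1 / 2 < c t₂ v₀ := hπt₀ ▸ hanti ⟨le_rfl, by linarith⟩ ⟨by linarith, by linarith⟩
      (by linarith)
    have l1 : c t₁ v₀ < 1 / 2 := hπt₀ ▸ hanti ⟨by linarith, by linarith⟩ ⟨by linarith, le_rfl⟩
      (by linarith)
    have e1 := hge (t₂ + 1) hI2 (by rwa [hper1]) (by rwa [hper1])
    have e2 := hle t₁ hI1 s1 l1
    rw [hper1] at e1
    have : G s (vertex v₀) - G s (vertex u₀) = (G s (vertex v₀) - G s (c t₂)) -
      (G s (c t₁) - G s (c t₂)) + (G s (c t₁) - G s (vertex u₀)) := by abel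
    rw [this, e1, e2, hmid] at hI₀
    rw [← sub_eq_zero, ← hT2, ← neg_eq_zero, ← hI₀]
    abel

end Loop

/-! ### Lifting the edge, and Riemann–Stieltjes sums. -/

section CurveIntegral

/-- A loop that a continuous injective map on a compact set carries onto its trace lifts to a
continuous periodic loop. -/
theorem exists_periodic_lift {X E : Type*} [TopologicalSpace X] [TopologicalSpace E] [T2Space E]
    {B : Set X} (hB : IsCompact B) {f : X → E} (hf : ContinuousOn f B) (hinj : InjOn f B)
    {γ : ℝ → E} (hγ : ContinuousOn γ (Icc 0 1)) (hclosed : γ 0 = γ 1)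
    (hγinj : InjOn γ (Ico 0 1)) (himage : f '' B = γ '' Icc 0 1) :
    ∃ c : ℝ → X, Continuous c ∧ Function.Periodic c 1 ∧ range c = B ∧
      (∀ t t', c t = c t' → ∃ n : ℤ, t - t' = n) ∧ ∀ t ∈ Icc (0 : ℝ) 1, f (c t) = γ t := by
  have hfr : ∀ t : ℝ, Int.fract t ∈ Icc (0 : ℝ) 1 := fun t =>
    ⟨Int.fract_nonneg t, (Int.fract_lt_one t).le⟩
  have hex : ∀ t : ℝ, ∃ x : B, f x = γ (Int.fract t) := fun t => by
    obtain ⟨x, hx, h⟩ : γ (Int.fract t) ∈ f '' B := himage ▸ mem_image_of_mem _ (hfr t)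
    exact ⟨⟨x, hx⟩, h⟩
  choose c hc using hex
  have : CompactSpace B := isCompact_iff_compactSpace.1 hB
  -- A continuous injection of a compact space into a Hausdorff space has a continuous inverse on
  -- its image, so the lift is continuous.
  have hemb : IsClosedEmbedding (B.domRestrict f) :=
    hf.domRestrict.isClosedEmbedding (injOn_iff_injective.1 hinj)
  have hcont : Continuous c := by
    rw [hemb.isInducing.continuous_iff]
    have h := ContinuousOn.comp_fract'' hγ hclosed
    exact h.congr fun t => (hc t).symm
  have hper : ∀ t, c (t + 1) = c t := fun t =>
    Subtype.ext (hinj (c _).2 (c _).2 (by rw [hc, hc, Int.fract_add_one]))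
  refine ⟨fun t => c t, continuous_subtype_val.comp hcont, fun t => by simp [hper], ?_, ?_, ?_⟩
  · refine Subset.antisymm (range_subset_iff.2 fun t => (c t).2) fun x hx => ?_
    obtain ⟨t, ht, h⟩ : f x ∈ γ '' Icc 0 1 := himage ▸ mem_image_of_mem _ hx
    have : f (c t) = f x := by
      rw [hc, ← h]
      rcases ht.2.eq_or_lt with rfl | hlt
      · simpa using hclosed
      · rw [Int.fract_eq_self.2 ⟨ht.1, hlt⟩]
    exact ⟨t, hinj (c t).2 hx this⟩
  · intro t t' h
    have h2 : γ (Int.fract t) = γ (Int.fract t') := by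
      rw [← hc, ← hc]
      exact congrArg f h
    exact Int.fract_eq_fract.1 (hγinj ⟨Int.fract_nonneg _, Int.fract_lt_one _⟩
      ⟨Int.fract_nonneg _, Int.fract_lt_one _⟩ h2)
  · intro t ht
    rw [hc]
    rcases ht.2.eq_or_lt with rfl | hlt
    · simpa using hclosed
    · rw [Int.fract_eq_self.2 ⟨ht.1, hlt⟩]

theorem sum_norm_sub_le_variation {E : Type*} [NormedAddCommGroup E] {γ : ℝ → E} {a b : ℝ}
    (hγ : BoundedVariationOn γ (Icc a b)) {p : ℕ} {t : ℕ → ℝ} (ht : ∀ i < p, t i ≤ t (i + 1))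
    (hmem : ∀ i ≤ p, t i ∈ Icc a b) :
    ∑ i ∈ Finset.range p, ‖γ (t (i + 1)) - γ (t i)‖ ≤ (eVariationOn γ (Icc a b)).toReal := by
  have hmono : MonotoneOn t (Iic p) := by
    intro i _ k hk hik
    induction k, hik using Nat.le_induction with
    | base => exact le_rfl
    | succ k hik ih =>
      have hk' : k + 1 ≤ p := hk
      exact (ih (by simp only [mem_Iic]; omega)).trans (ht k (by omega))
  have h := eVariationOn.sum_le_of_monotoneOn_Iic (f := γ) hmono hmem
  have h2 := ENNReal.toReal_mono hγ h
  rw [ENNReal.toReal_sum (fun _ _ => edist_ne_top _ _)] at h2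
  simpa only [← dist_edist, dist_eq_norm] using h2

theorem mem_Icc_of_partition {p : ℕ} {t : ℕ → ℝ} {a b : ℝ} (h0 : t 0 = a) (h1 : t p = b)
    (hmono : ∀ i < p, t i ≤ t (i + 1)) : ∀ i ≤ p, t i ∈ Icc a b := by
  have hge : ∀ i ≤ p, a ≤ t i := by
    intro i
    induction i with
    | zero => intro _; exact h0.ge
    | succ i ih => intro hi; exact (ih (by omega)).trans (hmono i (by omega))
  have hle : ∀ i ≤ p, t i ≤ b := by
    intro i hi
    induction hi using Nat.decreasingInduction with
    | self => exact h1.le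
    | of_succ k hk ih => exact (hmono k hk).trans ih
  exact fun i hi => ⟨hge i hi, hle i hi⟩

/-- Riemann–Stieltjes sums along a rectifiable curve are close to sums of segment integrals. -/
theorem exists_norm_sum_sub_segmentIntegral_lt {E V : Type*} [NormedAddCommGroup E]
    [NormedSpace ℝ E] [NormedAddCommGroup V] [NormedSpace ℝ V] [CompleteSpace V]
    (Λ : E →L[ℝ] V →L[ℝ] V) {Φ : E → V} {Ω : Set E} (hΩ : IsOpen Ω) (hΦ : ContinuousOn Φ Ω)
    {γ : ℝ → E} (hγ : ContinuousOn γ (Icc 0 1)) (hγΩ : γ '' Icc 0 1 ⊆ Ω)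
    (hvar : BoundedVariationOn γ (Icc 0 1)) {ε : ℝ} (hε : 0 < ε) :
    ∃ δ > (0 : ℝ), ∀ (p : ℕ) (t τ : ℕ → ℝ), t 0 = 0 → t p = 1 →
      (∀ i < p, t i ≤ τ i ∧ τ i ≤ t (i + 1) ∧ t (i + 1) - t i < δ) →
      ‖∑ i ∈ Finset.range p, (Λ (γ (t (i + 1)) - γ (t i)) (Φ (γ (τ i))) -
        segmentIntegral Λ Φ (γ (t i)) (γ (t (i + 1))))‖ < ε := by
  set L := (eVariationOn γ (Icc 0 1)).toReal with hL
  -- The factor `2` is there because both the tag value and the values on the chord are compared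
  -- with `Φ (γ (t i))`.
  obtain ⟨κ, hκ, hκε⟩ : ∃ κ > 0, ‖Λ‖ * L * (2 * κ) < ε := by
    refine ⟨ε / (2 * (‖Λ‖ * L + 1)), by positivity, ?_⟩
    have : (0 : ℝ) < ‖Λ‖ * L + 1 := by positivity
    calc ‖Λ‖ * L * (2 * (ε / (2 * (‖Λ‖ * L + 1)))) = ε * ((‖Λ‖ * L) / (‖Λ‖ * L + 1)) := by
          field_simp
      _ < ε * 1 := by
          refine mul_lt_mul_of_pos_left ((div_lt_one this).2 (lt_add_one _)) hε
      _ = ε := mul_one ε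
  have hcomp : IsCompact (γ '' Icc 0 1) := isCompact_Icc.image_of_continuousOn hγ
  obtain ⟨ρ₁, hρ₁, hρΩ⟩ := hcomp.exists_thickening_subset_open hΩ hγΩ
  have hunif := hcomp.uniformContinuousAt_of_continuousAt Φ
    (fun x hx => hΦ.continuousAt (hΩ.mem_nhds (hγΩ hx))) (Metric.dist_mem_uniformity hκ)
  obtain ⟨ρ₂, hρ₂, hρΦ⟩ := Metric.mem_uniformity_dist.1 hunif
  have hγu := isCompact_Icc.uniformContinuousOn_of_continuous hγ
  obtain ⟨δ, hδ, hγδ⟩ := Metric.uniformContinuousOn_iff.1 hγu (min ρ₁ ρ₂) (lt_min hρ₁ hρ₂)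
  refine ⟨δ, hδ, fun p t τ h0 h1 hpart => ?_⟩
  have hmono : ∀ i < p, t i ≤ t (i + 1) := fun i hi => (hpart i hi).1.trans (hpart i hi).2.1
  have hmem : ∀ i ≤ p, t i ∈ Icc (0 : ℝ) 1 := mem_Icc_of_partition h0 h1 hmono
  have hterm : ∀ i < p, ‖Λ (γ (t (i + 1)) - γ (t i)) (Φ (γ (τ i))) -
      segmentIntegral Λ Φ (γ (t i)) (γ (t (i + 1)))‖ ≤
      ‖Λ‖ * ‖γ (t (i + 1)) - γ (t i)‖ * (2 * κ) := by
    intro i hi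
    obtain ⟨p1, p2, p3⟩ := hpart i hi
    have m0 := hmem i hi.le
    have m1 := hmem (i + 1) hi
    have mτ : τ i ∈ Icc (0 : ℝ) 1 := ⟨m0.1.trans p1, p2.trans m1.2⟩
    have g0 : γ (t i) ∈ γ '' Icc 0 1 := mem_image_of_mem _ m0
    have d1 : dist (γ (t i)) (γ (t (i + 1))) < min ρ₁ ρ₂ := hγδ _ m0 _ m1 (by
      rw [Real.dist_eq, abs_sub_comm, abs_of_nonneg (by linarith)]; exact p3)
    have d2 : dist (γ (t i)) (γ (τ i)) < min ρ₁ ρ₂ := hγδ _ m0 _ mτ (by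
      rw [Real.dist_eq, abs_sub_comm, abs_of_nonneg (by linarith)]; linarith)
    have hseg : ∀ s ∈ Icc (0 : ℝ) 1,
        dist (γ (t i)) (γ (t i) + s • (γ (t (i + 1)) - γ (t i))) < min ρ₁ ρ₂ := by
      intro s hs
      refine lt_of_le_of_lt ?_ d1
      rw [dist_self_add_right, norm_smul, Real.norm_of_nonneg hs.1, dist_comm, dist_eq_norm]
      exact mul_le_of_le_one_left (norm_nonneg _) hs.2
    rw [norm_sub_rev]
    refine norm_segmentIntegral_sub_le (hΦ.comp (by fun_prop) fun s hs => hρΩ ?_) fun s hs => ?_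
    · refine Metric.mem_thickening_iff.2 ⟨_, g0, ?_⟩
      rw [dist_comm]
      exact (hseg s hs).trans_le (min_le_left _ _)
    · have q1 : dist (Φ (γ (t i))) (Φ (γ (t i) + s • (γ (t (i + 1)) - γ (t i)))) < κ :=
        hρΦ ((hseg s hs).trans_le (min_le_right _ _)) g0
      have q2 : dist (Φ (γ (t i))) (Φ (γ (τ i))) < κ := hρΦ (d2.trans_le (min_le_right _ _)) g0
      rw [← dist_eq_norm]
      refine (dist_triangle_left _ _ (Φ (γ (t i)))).trans ?_
      linarith
  refine (norm_sum_le _ _).trans_lt (lt_of_le_of_lt ?_ hκε)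
  refine (Finset.sum_le_sum fun i hi => hterm i (Finset.mem_range.1 hi)).trans ?_
  rw [← Finset.sum_mul, ← Finset.mul_sum]
  gcongr
  exact sum_norm_sub_le_variation hvar hmono hmem

end CurveIntegral

/-! ### The Cauchy theorem for the edge of a surface. -/

theorem theorem1 {A : Type*} [NormedCommRing A] [NormedAlgebra ℂ A] [FiniteDimensional ℂ A]
    {k : ℕ} (hk : 2 ≤ k) (e : Fin k → A) (he : LinearIndependent ℝ e)
    (he_one : e ⟨0, by omega⟩ = 1)
    (Ω : Set (realSpan e)) (hΩ_open : IsOpen Ω) (hΩ_conn : IsConnected Ω)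
    (Φ : realSpan e → A) (hΦ : IsMonogenicOn Φ Ω)
    {N : ℕ} (K : TriangulatedSurface N) (f : (Fin N → ℝ) → realSpan e)
    (hf : IsPiecewiseSmoothSurface K f) (hfΩ : f '' K.carrier ⊆ Ω)
    (γ : ℝ → realSpan e) (hγ : IsRectifiableJordanCurve γ) (hedge : IsEdgeOf γ K f) :
    HasCurveIntegral Φ γ 0 := by
  have : FiniteDimensional ℝ A := FiniteDimensional.complexToReal A
  have : CompleteSpace A := FiniteDimensional.complete ℝ A
  let Λ : realSpan e →L[ℝ] A →L[ℝ] A := (ContinuousLinearMap.mul ℝ A).comp (realSpan e).subtypeL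
  have hΛ : ∀ (h : realSpan e) (u : A), Λ h u = (h : A) * u := fun h u => rfl
  obtain ⟨hΦc, hΦd⟩ := hΦ
  have hbK := K.boundary_subset_carrier
  have hγf : γ '' Icc 0 1 ⊆ f '' K.carrier := hedge.2 ▸ image_mono hbK
  obtain ⟨c, hc, hper, hrange, hinj, hfc⟩ := exists_periodic_lift K.isCompact_boundary
    (hf.continuousOn.mono hbK) hedge.1 hγ.continuousOn hγ.closed hγ.injOn hedge.2
  obtain ⟨r, hr, hcocycle⟩ := exists_segmentIntegral_add (Λ := Λ) (Φ := Φ)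
    (fun h h' u => by simp only [hΛ]; ring) hΩ_open hΦc
    (fun x hx => by obtain ⟨d, hd⟩ := hΦd x hx; exact ⟨d, hd⟩)
    (K.isCompact_carrier.image_of_continuousOn hf.continuousOn) hfΩ
  obtain ⟨η, hη, hfη⟩ := Metric.uniformContinuousOn_iff.1
    (K.isCompact_carrier.uniformContinuousOn_of_continuous hf.continuousOn) r hr
  have hj : IsLocalCocycle (fun x y => segmentIntegral Λ Φ (f x) (f y)) K.carrier η := by
    intro x hx y hy z hz hxy _ hxz
    refine hcocycle (f x) (mem_image_of_mem f hx) _ (Metric.mem_ball_self hr) _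
      (Metric.mem_ball'.2 (hfη x hx y hy hxy)) _ (Metric.mem_ball'.2 (hfη x hx z hz hxz))
  have hcK : ∀ t, c t ∈ K.carrier := fun t => hbK (hrange ▸ mem_range_self t)
  -- The interval `[-1, 3]` exceeds one period on both sides, so that the primitive can be compared
  -- across the cut.
  obtain ⟨θ, hθ, hcθ⟩ := Metric.uniformContinuousOn_iff.1
    ((isCompact_Icc (a := (-1 : ℝ)) (b := 3)).uniformContinuousOn_of_continuous hc.continuousOn) η hη
  have hjc : IsLocalCocycle (fun t t' => segmentIntegral Λ Φ (f (c t)) (f (c t')))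
      (Icc (-1 : ℝ) 3) θ := fun x hx y hy z hz h1 h2 h3 =>
    hj _ (hcK x) _ (hcK y) _ (hcK z) (hcθ x hx y hy h1) (hcθ y hy z hz h2) (hcθ x hx z hz h3)
  obtain ⟨g, hg⟩ := hjc.exists_primitive hθ (convex_Icc _ _) (Metric.isBounded_Icc _ _)
  have hg01 : g 1 = g 0 := K.increment_boundary_loop_eq_zero hη hj hc hper hinj hrange
    (half_pos hθ) hg
  intro ε hε
  obtain ⟨δ, hδ, hsum⟩ := exists_norm_sum_sub_segmentIntegral_lt Λ hΩ_open hΦc hγ.continuousOn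
    (hγf.trans hfΩ) hγ.rectifiable hε
  refine ⟨min δ (θ / 2), lt_min hδ (half_pos hθ), fun p t τ h0 h1 hpart => ?_⟩
  have h := hsum p t τ h0 h1 fun i hi => ⟨(hpart i hi).1, (hpart i hi).2.1,
    (hpart i hi).2.2.trans_le (min_le_left _ _)⟩
  have hmono : ∀ i < p, t i ≤ t (i + 1) := fun i hi => (hpart i hi).1.trans (hpart i hi).2.1
  have hmem : ∀ i ≤ p, t i ∈ Icc (0 : ℝ) 1 := mem_Icc_of_partition h0 h1 hmono
  have hzero : ∑ i ∈ Finset.range p, segmentIntegral Λ Φ (γ (t i)) (γ (t (i + 1))) = 0 := by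
    have : ∀ i ∈ Finset.range p, segmentIntegral Λ Φ (γ (t i)) (γ (t (i + 1))) =
        g (t (i + 1)) - g (t i) := by
      intro i hi
      have hi := Finset.mem_range.1 hi
      have m0 := hmem i hi.le
      have m1 := hmem (i + 1) hi
      rw [← hfc _ m0, ← hfc _ m1]
      refine (hg _ ⟨by linarith [m0.1], by linarith [m0.2]⟩ _
        ⟨by linarith [m1.1], by linarith [m1.2]⟩ ?_).symm
      rw [dist_comm, Real.dist_eq, abs_of_nonneg (sub_nonneg.2 (hmono i hi))]
      exact (hpart i hi).2.2.trans_le (min_le_right _ _)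
    rw [Finset.sum_congr rfl this, Finset.sum_range_sub (fun i => g (t i)), h0, h1, hg01, sub_self]
  rw [Finset.sum_sub_distrib, hzero, sub_zero] at h
  rw [sub_zero]
  simpa only [hΛ, mul_comm] using h
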